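/- **Setting.** Let $(\mathcal X,\Delta)$ be a metric space equipped with a $\sigma$-algebra, let $\mu$ be a probability measure on $\mathcal X$, and let $f^*:\mathcal X\to[K]=\{1,\dots,K\}$ be a measurable ground-truth function. Let $\nu_d$ be the standard Gaussian measure $\mathcal N(0,I_d)$ on $\mathbb R^d$ with the Euclidean norm $\|\cdot\|_2$. Suppose $\mu$ is generated by a conditional generative model $\{(g_i,p_i)\}_{i\in[K]}$, that is, $g_i:\mathbb R^d\to\mathcal X$ is measurable, $p_i\in[0,1]$, and $\mu=\sum_{i=1}^K p_i\,\mu_i$, where $\mu_i=(g_i)_*\nu_d$ is the pushforward of $\nu_d$ under $g_i$. Write $\mathcal B(x,s)$ for the closed ball of radius $s$ around $x$. For a measurable classifier $f:\mathcal X\to[K]$, a probability measure $\rho$ on $\mathcal X$ and $\epsilon>0$ put $$\mathrm{Risk}_\rho(f)=\Pr_{x\sim\rho}\big[f(x)\ne f^*(x)\big],\qquad \mathrm{AdvRisk}^\epsilon_\mu(f)=\Pr_{x\sim\mu}\big[\exists\,x'\in\mathcal B(x,\epsilon):\ f(x')\neq f^*(x')\big],$$ $$\text{In-AdvRisk}^\epsilon_\mu(f)=\Pr_{(x,i)}\big[\exists\,z'\in\mathbb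 R^d:\ g_i(z')\in\mathcal B(x,\epsilon)\ \text{and}\ f(g_i(z'))\ne f^*(g_i(z'))\big],$$ where in the last probability $i$ is drawn with probability $p_i$ and, given $i$, $x\sim\mu_i$. (If an event is not measurable, its probability is understood as outer measure.) Let $\Phi$ be the cumulative distribution function of $\mathcal N(0,1)$, extended by $\Phi(-\infty)=0$ and $\Phi(+\infty)=1$, and let $\Phi^{-1}:[0,1]\to[-\infty,+\infty]$ be its inverse. **Theorem.** Let $\epsilon>0$, and suppose there are $r>0$, $\delta\in(0,1]$ and real numbers $L_i(r)$, $i\in[K]$, such that for every $i\in[K]$ one has $r\cdot L_i(r)\ge\epsilon$, and $g_i$ is $L_i(r)$-locally Lipschitz with probability at least $1-\delta$, that is, $$\Pr_{z\sim\nu_d}\big[\forall z'\in\mathcal B(z,r):\ \Delta(g_i(z'),g_i(z))\le L_i(r)\,\|z'-z\|_2\big]\ge 1-\delta .$$ Then for every measurable classifier $f:\mathcal X\to[K]$, $$\mathrm{AdvRisk}^\epsilon_\mu(f)\ \ge\ \text{In-AdvRisk}^\epsilon_\mu(f)\ \ge\ \sum_{i=1}^K p_i\,\Phi\Big(\Phi^{-1}\big(\mathrm{Risk}_{\mu_i}(f)\big)+\frac{\epsilon}{L_i(r)}\Big)-\delta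 .$$ -/

import Mathlib

open MeasureTheory ProbabilityTheory

noncomputable section

/-- Cumulative distribution function `Φ` of `N(0,1)`, on the extended real line, so that
`Φ(-∞) = 0` and `Φ(+∞) = 1`. -/
def Phi (x : EReal) : ℝ :=
  (gaussianReal 0 1).real {u : ℝ | (u : EReal) ≤ x}

/-- The inverse `Φ⁻¹ : [0,1] → [-∞,+∞]` of `Φ`, written as a quantile function
(see `Phi_PhiInv` and `PhiInv_Phi`). -/
def PhiInv (p : ℝ) : EReal :=
  sInf {x : EReal | p ≤ Phi x}

theorem Phi_coe (x : ℝ) : Phi (x : EReal) = cdf (gaussianReal 0 1) x := by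
  rw [cdf_eq_real, Phi]
  congr 1
  ext u
  simp

theorem Phi_strictMono : StrictMono Phi := by
  intro x y hxy
  obtain ⟨a, hxa, hay⟩ := EReal.lt_iff_exists_real_btwn.1 hxy
  obtain ⟨b, hab, hby⟩ := EReal.lt_iff_exists_real_btwn.1 hay
  have hab' : a < b := EReal.coe_lt_coe_iff.1 hab
  have hdisj : Disjoint {u : ℝ | (u : EReal) ≤ x} (Set.Ioo a b) := by
    rw [Set.disjoint_left]
    intro u hu hu'
    have h1 : (u : EReal) < a := lt_of_le_of_lt hu hxa
    exact absurd (EReal.coe_lt_coe_iff.1 h1) (not_lt.2 hu'.1.le)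
  have hsub : {u : ℝ | (u : EReal) ≤ x} ∪ Set.Ioo a b ⊆ {u : ℝ | (u : EReal) ≤ y} := by
    rintro u (hu | hu)
    · exact le_trans hu hxy.le
    · exact le_trans (EReal.coe_le_coe_iff.2 hu.2.le) hby.le
  have hpos : 0 < (gaussianReal 0 1).real (Set.Ioo a b) := by
    refine ENNReal.toReal_pos (fun h => ?_) (measure_ne_top _ _)
    have h2 := gaussianReal_absolutelyContinuous' 0 (one_ne_zero : (1 : NNReal) ≠ 0) h
    simp [Real.volume_Ioo] at h2
    linarith
  have h3 : (gaussianReal 0 1).real ({u : ℝ | (u : EReal) ≤ x} ∪ Set.Ioo a b)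
      = Phi x + (gaussianReal 0 1).real (Set.Ioo a b) :=
    measureReal_union hdisj measurableSet_Ioo
  have h4 : (gaussianReal 0 1).real ({u : ℝ | (u : EReal) ≤ x} ∪ Set.Ioo a b) ≤ Phi y :=
    measureReal_mono hsub
  linarith

theorem PhiInv_Phi (x : EReal) : PhiInv (Phi x) = x := by
  have h : {y : EReal | Phi x ≤ Phi y} = Set.Ici x := by
    ext y
    exact Phi_strictMono.le_iff_le
  rw [PhiInv, h]
  exact csInf_Ici

theorem exists_Phi_eq {p : ℝ} (hp : p ∈ Set.Icc (0 : ℝ) 1) : ∃ x : EReal, Phi x = p := by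
  rcases hp.1.eq_or_lt with h0 | h0
  · exact ⟨⊥, by simp [Phi, ← h0]⟩
  rcases hp.2.eq_or_lt with h1 | h1
  · exact ⟨⊤, by simp [Phi, h1]⟩
  have hc : Continuous (cdf (gaussianReal 0 1)) := by
    rw [continuous_iff_continuousAt]
    intro x
    have : NullSingletonClass (gaussianReal 0 1) :=
      nullSingletonClass_gaussianReal one_ne_zero
    have hx : (cdf (gaussianReal 0 1)).measure {x} = 0 := by
      rw [measure_cdf]
      exact measure_singleton x
    rw [StieltjesFunction.measure_singleton, ENNReal.ofReal_eq_zero] at hx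
    rw [(monotone_cdf _).continuousAt_iff_leftLim_eq_rightLim, StieltjesFunction.rightLim_eq]
    exact le_antisymm ((monotone_cdf _).leftLim_le le_rfl) (by linarith)
  obtain ⟨x, hx⟩ := mem_range_of_exists_le_of_exists_ge hc
    (((tendsto_cdf_atBot (gaussianReal 0 1)).eventually (gt_mem_nhds h0)).exists.imp
      fun _ h => h.le)
    (((tendsto_cdf_atTop (gaussianReal 0 1)).eventually (lt_mem_nhds h1)).exists.imp
      fun _ h => h.le)
  exact ⟨x, by rw [Phi_coe, hx]⟩

theorem Phi_PhiInv {p : ℝ} (hp : p ∈ Set.Icc (0 : ℝ) 1) : Phi (PhiInv p) = p := by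
  obtain ⟨x, rfl⟩ := exists_Phi_eq hp
  rw [PhiInv_Phi]

/-- The standard Gaussian measure `ν_d` on `ℝ^d` with the Euclidean norm. -/
abbrev nu (d : ℕ) : Measure (EuclideanSpace ℝ (Fin d)) :=
  stdGaussian (EuclideanSpace ℝ (Fin d))

/-- `Risk_μ(f) = Pr_{x ∼ μ}[f x ≠ f* x]`. -/
def Risk {X Y : Type*} [MeasurableSpace X] (μ : Measure X) (fstar f : X → Y) : ℝ :=
  μ.real {x | f x ≠ fstar x}

/-- `AdvRisk_μ^ε(f) = Pr_{x ∼ μ}[∃ x' ∈ B(x,ε), f x' ≠ f* x']`, with closed balls. As always for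
a Mathlib measure, an event that is not measurable gets its outer measure. -/
def AdvRisk {X Y : Type*} [MetricSpace X] [MeasurableSpace X] (μ : Measure X)
    (fstar f : X → Y) (ε : ℝ) : ℝ :=
  μ.real {x | ∃ x' ∈ Metric.closedBall x ε, f x' ≠ fstar x'}

/-- A conditional generative model `{(g_i, p_i)}_{i ∈ [K]}` with latent space `ℝ^d`. -/
structure CondGenModel (d K : ℕ) (X : Type*) [MeasurableSpace X] where
  /-- the generator of each class -/
  g : Fin K → EuclideanSpace ℝ (Fin d) → X
  measurable_g : ∀ i, Measurable (g i)
  /-- the probability of each class -/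
  p : Fin K → ℝ
  p_mem : ∀ i, p i ∈ Set.Icc (0 : ℝ) 1

namespace CondGenModel

/-- The distribution `μ_i = (g_i)_* ν_d` of class `i`. -/
def classMeasure {d K : ℕ} {X : Type*} [MeasurableSpace X]
    (M : CondGenModel d K X) (i : Fin K) : Measure X :=
  (nu d).map (M.g i)

/-- `μ` is generated by the model: `μ = ∑ i, p_i • (g_i)_* ν_d`. -/
def Generates {d K : ℕ} {X : Type*} [MeasurableSpace X]
    (M : CondGenModel d K X) (μ : Measure X) : Prop :=
  μ = ∑ i, ENNReal.ofReal (M.p i) • M.classMeasure i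

/-- The joint law of `(x, i)`: the class `i` has probability `p_i` and, given `i`, the point `x`
is distributed as `(g_i)_* ν_d`. -/
def jointMeasure {d K : ℕ} {X : Type*} [MeasurableSpace X]
    (M : CondGenModel d K X) : Measure (X × Fin K) :=
  ∑ i, ENNReal.ofReal (M.p i) • (M.classMeasure i).map (fun x => (x, i))

/-- `In-AdvRisk^ε(f) =
Pr_{(x,i)}[∃ z', g_i z' ∈ B(x,ε) and f (g_i z') ≠ f* (g_i z')]`, with closed balls. -/
def InAdvRisk {d K : ℕ} {X Y : Type*} [MetricSpace X] [MeasurableSpace X]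
    (M : CondGenModel d K X) (fstar f : X → Y) (ε : ℝ) : ℝ :=
  M.jointMeasure.real
    {q : X × Fin K | ∃ z' : EuclideanSpace ℝ (Fin d),
      M.g q.2 z' ∈ Metric.closedBall q.1 ε ∧ f (M.g q.2 z') ≠ fstar (M.g q.2 z')}

end CondGenModel

/-- `g` is `L`-locally Lipschitz at radius `r` with probability at least `1 - δ`. -/
def LocLipschitzWithProb {d : ℕ} {X : Type*} [MetricSpace X]
    (g : EuclideanSpace ℝ (Fin d) → X) (r L δ : ℝ) : Prop :=
  1 - δ ≤ (nu d).real {z | ∀ z' ∈ Metric.closedBall z r, dist (g z') (g z) ≤ L * ‖z' - z‖}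

end

/-! The theorem is Gaussian isoperimetry in latent space. For class `i`, let `S` be the set of
latent points whose image is misclassified; its Gaussian measure is the risk of `f` under `μ_i`.
With `s = ε / L_i(r) ≤ r`, any `z` that is within `s` of `S` and satisfies the local Lipschitz
condition has a misclassified generated point within `ε` of `g_i z`. The isoperimetric inequality
gives the `s`-neighborhood of `S` measure at least `Φ(Φ⁻¹(ν(S)) + s)`, and the exceptional set costs
at most `δ`. Averaging with the weights `p_i`, which sum to `1`, gives the second inequality. The
first holds because an in-distribution adversarial point is in particular an adversarial point.

Isoperimetry is proved by Bobkov's method. The profile `I = φ ∘ Φ⁻¹` satisfies `I I'' = -1`, which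
yields the two-point inequality `two_point`. Induction over coordinates turns it into a functional
inequality on the discrete cube (`bobkov_cube`), and the central limit theorem carries this to
Gaussian space: `I(∫ f) ≤ ∫ (I(f) + ‖∇f‖)` for smooth compactly supported `f`
(`bobkov_stdGaussian`).

Applied to a cutoff between a compact `A` and its `τ`-thickening, this says to first order that the
quantile of the measure of a thickening grows at speed at least `1` in the radius. Many small steps
give the full inequality (`quantile_add_le_cthickening`), and inner regularity extends it to
measurable sets. -/

open Filter Topology

/-! ### The Gaussian density, quantile function and isoperimetric profile -/

/-- The density of `N(0,1)`. -/
noncomputable def stdDensity (x : ℝ) : ℝ := (√(2 * Real.pi))⁻¹ * Real.exp (-x ^ 2 / 2)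

theorem gaussianPDFReal_zero_one : gaussianPDFReal 0 1 = stdDensity := by
  ext x
  simp [gaussianPDFReal_def, stdDensity]

theorem stdDensity_pos (x : ℝ) : 0 < stdDensity x := by
  unfold stdDensity; positivity

theorem stdDensity_neg (x : ℝ) : stdDensity (-x) = stdDensity x := by
  simp [stdDensity]

theorem continuous_stdDensity : Continuous stdDensity := by
  unfold stdDensity; fun_prop

theorem stdDensity_eq_mul_exp (x y : ℝ) :
    stdDensity x = stdDensity y * Real.exp ((y ^ 2 - x ^ 2) / 2) := by
  unfold stdDensity
  rw [mul_assoc, ← Real.exp_add]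
  congr 2
  ring

theorem stdDensity_le_of_abs_le {x y : ℝ} (h : |x| ≤ |y|) : stdDensity y ≤ stdDensity x := by
  rw [stdDensity_eq_mul_exp x y]
  refine le_mul_of_one_le_right (stdDensity_pos y).le (Real.one_le_exp ?_)
  have := sq_le_sq.2 h
  linarith

theorem stdDensity_le_one (x : ℝ) : stdDensity x ≤ 1 := by
  refine (stdDensity_le_of_abs_le (x := 0) (by simp)).trans ?_
  simp only [stdDensity, ne_eq, OfNat.ofNat_ne_zero, not_false_eq_true, zero_pow, neg_zero,
    zero_div, Real.exp_zero, mul_one]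
  refine inv_le_one_of_one_le₀ (Real.one_le_sqrt.2 ?_)
  linarith [Real.pi_gt_three]

theorem hasDerivAt_stdDensity (x : ℝ) : HasDerivAt stdDensity (-x * stdDensity x) x := by
  have h : HasDerivAt (fun x : ℝ => -x ^ 2 / 2) (-x) x :=
    ((hasDerivAt_pow 2 x).neg.div_const 2).congr_deriv (by norm_num; ring)
  exact (h.exp.const_mul (√(2 * Real.pi))⁻¹).congr_deriv (by unfold stdDensity; ring)

theorem tendsto_stdDensity_atTop : Tendsto stdDensity atTop (𝓝 0) := by
  have h : Tendsto (fun x : ℝ => -x ^ 2 / 2) atTop atBot := by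
    have h2 : Tendsto (fun x : ℝ => x ^ 2 / 2) atTop atTop :=
      (tendsto_pow_atTop two_ne_zero).atTop_div_const two_pos
    refine (tendsto_neg_atTop_atBot.comp h2).congr fun x => ?_
    simp [neg_div]
  have h2 := (Real.tendsto_exp_atBot.comp h).const_mul (√(2 * Real.pi))⁻¹
  rwa [mul_zero] at h2

theorem Phi_coe_eq_integral (x : ℝ) : Phi x = ∫ u in Set.Iic x, stdDensity u := by
  rw [← gaussianPDFReal_zero_one, Phi, Measure.real, gaussianReal_apply_eq_integral 0 one_ne_zero,
    ENNReal.toReal_ofReal]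
  · congr 2
    ext u
    simp
  · exact integral_nonneg fun u => gaussianPDFReal_nonneg 0 1 u

theorem hasDerivAt_Phi (x : ℝ) : HasDerivAt (fun y : ℝ => Phi y) (stdDensity x) x := by
  have hint : Integrable stdDensity := by
    rw [← gaussianPDFReal_zero_one]; exact integrable_gaussianPDFReal 0 1
  have h := (intervalIntegral.integral_hasDerivAt_right (a := 0) (b := x)
    hint.intervalIntegrable
    (continuous_stdDensity.stronglyMeasurableAtFilter _ _)
    continuous_stdDensity.continuousAt).add_const (Phi (0 : ℝ))
  refine h.congr_of_eventuallyEq (Eventually.of_forall fun y => ?_)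
  have := intervalIntegral.integral_Iic_sub_Iic (a := 0) (b := y) hint.integrableOn
    hint.integrableOn
  simp only [Phi_coe_eq_integral, ← this]
  ring

theorem continuous_Phi_coe : Continuous fun y : ℝ => Phi y :=
  continuous_iff_continuousAt.2 fun x => (hasDerivAt_Phi x).continuousAt

theorem Phi_top : Phi ⊤ = 1 := by simp [Phi]

theorem Phi_bot : Phi ⊥ = 0 := by simp [Phi]

theorem Phi_coe_mem_Ioo (x : ℝ) : Phi x ∈ Set.Ioo (0 : ℝ) 1 :=
  ⟨Phi_bot ▸ Phi_strictMono (EReal.bot_lt_coe x), Phi_top ▸ Phi_strictMono (EReal.coe_lt_top x)⟩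

theorem Phi_neg_coe (x : ℝ) : Phi ((-x : ℝ) : EReal) = 1 - Phi x := by
  have hatom : NullSingletonClass (gaussianReal 0 1) :=
    nullSingletonClass_gaussianReal one_ne_zero
  have h1 : (gaussianReal 0 1).real (Set.Iic (-x)) = (gaussianReal 0 1).real (Set.Ioi x) := by
    have hm : Measure.map (fun x => -x) (gaussianReal 0 1) = gaussianReal 0 1 := by
      simpa using gaussianReal_map_neg (μ := 0) (v := 1)
    conv_lhs => rw [← hm]
    rw [map_measureReal_apply measurable_neg measurableSet_Iic]
    have : (fun x : ℝ => -x) ⁻¹' Set.Iic (-x) = Set.Ici x := by ext; simp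
    rw [this]
    exact measureReal_congr Ioi_ae_eq_Ici.symm
  have h2 := probReal_compl_eq_one_sub (μ := gaussianReal 0 1) (measurableSet_Iic (a := x))
  rw [Set.compl_Iic] at h2
  have h3 : ∀ y : ℝ, Phi y = (gaussianReal 0 1).real (Set.Iic y) := fun y => by
    rw [Phi]; congr 1; ext u; simp
  rw [h3, h3, h1, h2]

/-- The real-valued quantile function of `N(0,1)`. -/
noncomputable def quantile (p : ℝ) : ℝ := (PhiInv p).toReal

theorem quantile_Phi (y : ℝ) : quantile (Phi y) = y := by
  rw [quantile, PhiInv_Phi, EReal.toReal_coe]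

theorem exists_eq_Phi_coe {p : ℝ} (hp : p ∈ Set.Ioo (0 : ℝ) 1) : ∃ y : ℝ, p = Phi y := by
  obtain ⟨x, rfl⟩ := exists_Phi_eq (Set.Ioo_subset_Icc_self hp)
  induction x with
  | bot => simp [Phi_bot] at hp
  | top => simp [Phi_top] at hp
  | coe x => exact ⟨x, rfl⟩

theorem Phi_quantile {p : ℝ} (hp : p ∈ Set.Ioo (0 : ℝ) 1) : Phi (quantile p) = p := by
  obtain ⟨y, rfl⟩ := exists_eq_Phi_coe hp
  rw [quantile_Phi]

theorem coe_quantile {p : ℝ} (hp : p ∈ Set.Ioo (0 : ℝ) 1) : (quantile p : EReal) = PhiInv p := by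
  obtain ⟨y, rfl⟩ := exists_eq_Phi_coe hp
  rw [quantile_Phi, PhiInv_Phi]

theorem strictMonoOn_quantile : StrictMonoOn quantile (Set.Ioo 0 1) := by
  intro p hp p' hp' h
  obtain ⟨y, rfl⟩ := exists_eq_Phi_coe hp
  obtain ⟨y', rfl⟩ := exists_eq_Phi_coe hp'
  rw [quantile_Phi, quantile_Phi]
  exact EReal.coe_lt_coe_iff.1 (Phi_strictMono.lt_iff_lt.1 h)

theorem quantile_one_sub {p : ℝ} (hp : p ∈ Set.Ioo (0 : ℝ) 1) :
    quantile (1 - p) = -quantile p := by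
  obtain ⟨y, rfl⟩ := exists_eq_Phi_coe hp
  rw [← Phi_neg_coe, quantile_Phi, quantile_Phi]

/-- A monotone function cannot jump when it maps `(0,1)` onto the whole line. -/
theorem continuousAt_quantile {p : ℝ} (hp : p ∈ Set.Ioo (0 : ℝ) 1) : ContinuousAt quantile p := by
  refine strictMonoOn_quantile.continuousAt_of_image_mem_nhds (Ioo_mem_nhds hp.1 hp.2) ?_
  convert univ_mem
  refine Set.eq_univ_of_forall fun y => ⟨Phi y, Phi_coe_mem_Ioo y, quantile_Phi y⟩

theorem hasDerivAt_quantile {p : ℝ} (hp : p ∈ Set.Ioo (0 : ℝ) 1) :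
    HasDerivAt quantile (stdDensity (quantile p))⁻¹ p := by
  refine HasDerivAt.of_local_left_inverse (continuousAt_quantile hp) (hasDerivAt_Phi _)
    (stdDensity_pos _).ne' ?_
  filter_upwards [Ioo_mem_nhds hp.1 hp.2] with y hy using Phi_quantile hy

open Classical in
/-- The Gaussian isoperimetric profile `φ ∘ Φ⁻¹` on `(0,1)`, extended by `0`. -/
noncomputable def isoProfile (p : ℝ) : ℝ :=
  if p ∈ Set.Ioo (0 : ℝ) 1 then stdDensity (quantile p) else 0

theorem isoProfile_of_mem {p : ℝ} (hp : p ∈ Set.Ioo (0 : ℝ) 1) :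
    isoProfile p = stdDensity (quantile p) := if_pos hp

theorem isoProfile_of_notMem {p : ℝ} (hp : p ∉ Set.Ioo (0 : ℝ) 1) : isoProfile p = 0 := if_neg hp

theorem isoProfile_zero : isoProfile 0 = 0 := isoProfile_of_notMem (by simp)

theorem isoProfile_one : isoProfile 1 = 0 := isoProfile_of_notMem (by simp)

theorem isoProfile_pos {p : ℝ} (hp : p ∈ Set.Ioo (0 : ℝ) 1) : 0 < isoProfile p := by
  rw [isoProfile_of_mem hp]; exact stdDensity_pos _

theorem isoProfile_nonneg (p : ℝ) : 0 ≤ isoProfile p := by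
  by_cases hp : p ∈ Set.Ioo (0 : ℝ) 1
  · exact (isoProfile_pos hp).le
  · rw [isoProfile_of_notMem hp]

theorem isoProfile_le_one (p : ℝ) : isoProfile p ≤ 1 := by
  by_cases hp : p ∈ Set.Ioo (0 : ℝ) 1
  · rw [isoProfile_of_mem hp]; exact stdDensity_le_one _
  · rw [isoProfile_of_notMem hp]; exact zero_le_one

theorem one_sub_mem_Ioo_iff {p : ℝ} : 1 - p ∈ Set.Ioo (0 : ℝ) 1 ↔ p ∈ Set.Ioo (0 : ℝ) 1 := by
  simp only [Set.mem_Ioo]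
  constructor <;> rintro ⟨h, h'⟩ <;> constructor <;> linarith

theorem isoProfile_one_sub (p : ℝ) : isoProfile (1 - p) = isoProfile p := by
  by_cases hp : p ∈ Set.Ioo (0 : ℝ) 1
  · rw [isoProfile_of_mem hp, isoProfile_of_mem (one_sub_mem_Ioo_iff.2 hp), quantile_one_sub hp,
      stdDensity_neg]
  · rw [isoProfile_of_notMem hp, isoProfile_of_notMem (mt one_sub_mem_Ioo_iff.1 hp)]

/-- In the chain rule the factor `φ` of `φ' = -yφ` cancels the derivative `1/φ` of the quantile.
Differentiating once more gives `I I'' = -1`. -/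
theorem hasDerivAt_isoProfile {p : ℝ} (hp : p ∈ Set.Ioo (0 : ℝ) 1) :
    HasDerivAt isoProfile (-quantile p) p := by
  have h := (hasDerivAt_stdDensity (quantile p)).comp p (hasDerivAt_quantile hp)
  rw [mul_assoc, mul_inv_cancel₀ (stdDensity_pos _).ne', mul_one] at h
  refine h.congr_of_eventuallyEq ?_
  filter_upwards [Ioo_mem_nhds hp.1 hp.2] with y hy using isoProfile_of_mem hy

/-- As `p` decreases to `0` the quantile tends to `-∞`, where the density vanishes; for `p ≤ 0` the
extension by `0` applies. -/
theorem continuousAt_isoProfile_zero : ContinuousAt isoProfile 0 := by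
  rw [ContinuousAt, isoProfile_zero]
  refine tendsto_order.2 ⟨fun a ha => Eventually.of_forall fun p =>
    ha.trans_le (isoProfile_nonneg p), fun ε hε => ?_⟩
  obtain ⟨y, hy0, hy⟩ := ((eventually_ge_atTop 0).and
    (tendsto_stdDensity_atTop.eventually (gt_mem_nhds hε))).exists
  filter_upwards [gt_mem_nhds (Phi_coe_mem_Ioo (-y)).1] with p hp
  by_cases hp' : p ∈ Set.Ioo (0 : ℝ) 1
  · rw [isoProfile_of_mem hp']
    refine lt_of_le_of_lt (stdDensity_le_of_abs_le ?_) hy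
    have := strictMonoOn_quantile hp' (Phi_coe_mem_Ioo (-y)) hp
    rw [quantile_Phi] at this
    rw [abs_of_nonneg hy0, abs_of_neg (by linarith)]
    linarith
  · rwa [isoProfile_of_notMem hp']

theorem continuous_isoProfile : Continuous isoProfile := by
  refine continuous_iff_continuousAt.2 fun p => ?_
  by_cases hp : p ∈ Set.Ioo (0 : ℝ) 1
  · exact (hasDerivAt_isoProfile hp).continuousAt
  rcases eq_or_ne p 0 with rfl | h0
  · exact continuousAt_isoProfile_zero
  rcases eq_or_ne p 1 with rfl | h1
  · have h : ContinuousAt isoProfile (1 - 1) := by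
      rw [sub_self]; exact continuousAt_isoProfile_zero
    have h2 : ContinuousAt (fun p : ℝ => isoProfile (1 - p)) 1 :=
      ContinuousAt.comp (g := isoProfile) (f := fun p : ℝ => 1 - p) h (by fun_prop)
    simpa only [isoProfile_one_sub] using h2
  · have hmem : (Set.Icc (0 : ℝ) 1)ᶜ ∈ 𝓝 p := by
      refine isClosed_Icc.isOpen_compl.mem_nhds fun h => hp ⟨?_, ?_⟩
      · exact lt_of_le_of_ne h.1 h0.symm
      · exact lt_of_le_of_ne h.2 h1
    refine (continuousAt_const (y := (0 : ℝ))).congr ?_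
    filter_upwards [hmem] with y hy
    exact (isoProfile_of_notMem fun h => hy (Set.Ioo_subset_Icc_self h)).symm

/-- The isoperimetric profile is quasi-concave. -/
theorem min_isoProfile_le {a b p : ℝ} (ha : 0 ≤ a) (hb : b ≤ 1) (hap : a ≤ p) (hpb : p ≤ b) :
    min (isoProfile a) (isoProfile b) ≤ isoProfile p := by
  rcases ha.eq_or_lt with rfl | ha
  · exact (min_le_left _ _).trans (isoProfile_zero.trans_le (isoProfile_nonneg p))
  rcases hb.eq_or_lt with rfl | hb
  · exact (min_le_right _ _).trans (isoProfile_one.trans_le (isoProfile_nonneg p))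
  have hma : a ∈ Set.Ioo (0 : ℝ) 1 := ⟨ha, by linarith⟩
  have hmb : b ∈ Set.Ioo (0 : ℝ) 1 := ⟨by linarith, hb⟩
  have hmp : p ∈ Set.Ioo (0 : ℝ) 1 := ⟨by linarith, by linarith⟩
  rw [isoProfile_of_mem hma, isoProfile_of_mem hmb, isoProfile_of_mem hmp]
  have h1 := strictMonoOn_quantile.monotoneOn hma hmp hap
  have h2 := strictMonoOn_quantile.monotoneOn hmp hmb hpb
  rcases le_total 0 (quantile p) with h | h
  · refine (min_le_right _ _).trans (stdDensity_le_of_abs_le ?_)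
    rw [abs_of_nonneg h, abs_of_nonneg (h.trans h2)]
    exact h2
  · refine (min_le_left _ _).trans (stdDensity_le_of_abs_le ?_)
    rw [abs_of_nonpos h, abs_of_nonpos (h1.trans h)]
    linarith

/-! ### Bobkov's two-point inequality -/

theorem nonneg_of_deriv_nonneg {f f' : ℝ → ℝ} {b : ℝ}
    (hf : ∀ t ∈ Set.Icc 0 b, HasDerivAt f (f' t) t) (h0 : 0 ≤ f 0)
    (hf' : ∀ t ∈ Set.Icc 0 b, 0 ≤ f' t) : ∀ t ∈ Set.Icc 0 b, 0 ≤ f t := by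
  intro t ht
  have hmono : MonotoneOn f (Set.Icc 0 b) := by
    refine monotoneOn_of_hasDerivWithinAt_nonneg (convex_Icc 0 b)
      (fun s hs => (hf s hs).continuousAt.continuousWithinAt)
      (fun s hs => (hf s (interior_subset hs)).hasDerivWithinAt)
      (fun s hs => hf' s (interior_subset hs))
  exact h0.trans (hmono ⟨le_rfl, ht.1.trans ht.2⟩ ht ht.1)

/-- Up to a factor `2` this is the derivative of the squared quantile at `p = Φ(y)`, so its
monotonicity is convexity of the squared quantile. -/
theorem monotone_div_stdDensity : Monotone fun y : ℝ => y / stdDensity y := by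
  have h0 : ∀ {x y : ℝ}, 0 ≤ x → x ≤ y → x / stdDensity x ≤ y / stdDensity y := by
    intro x y hx hxy
    refine div_le_div₀ (hx.trans hxy) hxy (stdDensity_pos _) (stdDensity_le_of_abs_le ?_)
    rwa [abs_of_nonneg hx, abs_of_nonneg (hx.trans hxy)]
  intro x y hxy
  rcases le_total 0 x with hx | hx
  · exact h0 hx hxy
  rcases le_total 0 y with hy | hy
  · exact (div_nonpos_of_nonpos_of_nonneg hx (stdDensity_pos _).le).trans
      (div_nonneg hy (stdDensity_pos _).le)
  · have := h0 (neg_nonneg.2 hy) (neg_le_neg hxy)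
    rw [stdDensity_neg, stdDensity_neg, neg_div, neg_div] at this
    exact neg_le_neg_iff.1 this

/-- The point `p` lies between `p'` and its mirror image `1 - p'`, and the quantile is odd about
`1/2`. -/
theorem abs_quantile_le {p p' : ℝ} (hp : p ∈ Set.Ioo (0 : ℝ) 1) (hp' : p' ∈ Set.Ioo (0 : ℝ) 1)
    (h : p' ≤ p) (h1 : p + p' ≤ 1) : |quantile p| ≤ -quantile p' := by
  have hq := strictMonoOn_quantile.monotoneOn
  rw [abs_le, neg_neg]
  refine ⟨hq hp' hp h, ?_⟩
  rw [← quantile_one_sub hp']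
  exact hq hp (one_sub_mem_Ioo_iff.2 hp') (by linarith)

theorem isoProfile_le_of_add_le_one {p p' : ℝ} (hp : p ∈ Set.Ioo (0 : ℝ) 1)
    (hp' : p' ∈ Set.Ioo (0 : ℝ) 1) (h : p' ≤ p) (h1 : p + p' ≤ 1) :
    isoProfile p' ≤ isoProfile p := by
  rw [isoProfile_of_mem hp, isoProfile_of_mem hp']
  refine stdDensity_le_of_abs_le ((abs_quantile_le hp hp' h h1).trans ?_)
  exact neg_le_abs _

theorem hasDerivAt_isoProfile_sq {p : ℝ} (hp : p ∈ Set.Ioo (0 : ℝ) 1) :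
    HasDerivAt (fun p => isoProfile p ^ 2) (-2 * isoProfile p * quantile p) p := by
  refine ((hasDerivAt_isoProfile hp).pow 2).congr_deriv ?_
  norm_num

theorem hasDerivAt_deriv_isoProfile_sq {p : ℝ} (hp : p ∈ Set.Ioo (0 : ℝ) 1) :
    HasDerivAt (fun p => -2 * isoProfile p * quantile p) (2 * quantile p ^ 2 - 2) p := by
  refine (((hasDerivAt_isoProfile hp).const_mul (-2)).mul (hasDerivAt_quantile hp)).congr_deriv ?_
  have : isoProfile p * (stdDensity (quantile p))⁻¹ = 1 := by
    rw [isoProfile_of_mem hp, mul_inv_cancel₀ (stdDensity_pos _).ne']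
  linear_combination (-2) * this

theorem hasDerivAt_quantile_sq {p : ℝ} (hp : p ∈ Set.Ioo (0 : ℝ) 1) :
    HasDerivAt (fun p => quantile p ^ 2) (2 * (quantile p / stdDensity (quantile p))) p := by
  refine ((hasDerivAt_quantile hp).pow 2).congr_deriv ?_
  simp
  ring

section TwoPoint

variable {c x : ℝ}

theorem add_mem_Ioo (hm : 0 < c - x) (hp : c + x < 1) {t : ℝ} (ht : t ∈ Set.Icc 0 x) :
    c + t ∈ Set.Ioo (0 : ℝ) 1 := ⟨by linarith [ht.1, ht.2], by linarith [ht.2]⟩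

theorem sub_mem_Ioo (hm : 0 < c - x) (hp : c + x < 1) {t : ℝ} (ht : t ∈ Set.Icc 0 x) :
    c - t ∈ Set.Ioo (0 : ℝ) 1 := ⟨by linarith [ht.1, ht.2], by linarith [ht.1, ht.2]⟩

/-- Midpoint convexity of the squared quantile. -/
theorem two_mul_quantile_sq_le (hx : 0 ≤ x) (hm : 0 < c - x) (hp : c + x < 1) :
    2 * quantile c ^ 2 ≤ quantile (c + x) ^ 2 + quantile (c - x) ^ 2 := by
  have := nonneg_of_deriv_nonneg (b := x)
    (f := fun t => quantile (c + t) ^ 2 + quantile (c - t) ^ 2 - 2 * quantile c ^ 2)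
    (fun t ht => (((hasDerivAt_quantile_sq (add_mem_Ioo hm hp ht)).comp_const_add c t).add
      ((hasDerivAt_quantile_sq (sub_mem_Ioo hm hp ht)).comp_const_sub c t)).sub_const _)
    (by simp; linarith) (fun t ht => ?_) x ⟨hx, le_rfl⟩
  · linarith
  · have h1 := strictMonoOn_quantile.monotoneOn (sub_mem_Ioo hm hp ht) (add_mem_Ioo hm hp ht)
      (by linarith [ht.1])
    have h2 := monotone_div_stdDensity h1
    simp only at h2
    linarith

/-- Writing `q` for the quantile, `(I²)'' = 2q² - 2`. Convexity of `q²` bounds the second derivative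
of `I(c+t)² + I(c-t)²` below by `4q(c)² - 4`; the claim follows by integrating twice from `t = 0`.
-/
theorem isoProfile_sq_add_ge (hx : 0 ≤ x) (hm : 0 < c - x) (hp : c + x < 1) :
    2 * quantile c ^ 2 * x ^ 2 ≤
      isoProfile (c + x) ^ 2 + isoProfile (c - x) ^ 2 + 2 * x ^ 2 - 2 * isoProfile c ^ 2 := by
  have hd : ∀ t ∈ Set.Icc 0 x, 0 ≤ -2 * isoProfile (c + t) * quantile (c + t)
      + -(-2 * isoProfile (c - t) * quantile (c - t)) + (4 - 4 * quantile c ^ 2) * t := by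
    refine nonneg_of_deriv_nonneg (fun t ht =>
      (((hasDerivAt_deriv_isoProfile_sq (add_mem_Ioo hm hp ht)).comp_const_add c t).add
        ((hasDerivAt_deriv_isoProfile_sq (sub_mem_Ioo hm hp ht)).comp_const_sub c t).neg).add
          ((hasDerivAt_id t).const_mul (4 - 4 * quantile c ^ 2))) (by simp) (fun t ht => ?_)
    have := two_mul_quantile_sq_le (c := c) (x := t) ht.1 (by linarith [ht.2]) (by linarith [ht.2])
    linarith
  have := nonneg_of_deriv_nonneg (b := x)
    (f := fun t => isoProfile (c + t) ^ 2 + isoProfile (c - t) ^ 2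
      + (2 - 2 * quantile c ^ 2) * t ^ 2 - 2 * isoProfile c ^ 2)
    (fun t ht => ((((hasDerivAt_isoProfile_sq (add_mem_Ioo hm hp ht)).comp_const_add c t).add
      ((hasDerivAt_isoProfile_sq (sub_mem_Ioo hm hp ht)).comp_const_sub c t)).add
        ((hasDerivAt_pow 2 t).const_mul (2 - 2 * quantile c ^ 2))).sub_const _)
    (by simp; linarith) (fun t ht => ?_) x ⟨hx, le_rfl⟩
  · linarith
  · have := hd t ht
    simp only [Nat.cast_ofNat, Nat.add_one_sub_one, pow_one]
    linarith

/-- For `c ≤ 1/2` one has `|q(c+t)| ≤ |q(c-t)|`, so `I(c+t)² - I(c-t)²` is concave in `t` and lies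
below its tangent at `0`. -/
theorem isoProfile_sq_sub_le (hc : c ≤ 1 / 2) (hx : 0 ≤ x) (hm : 0 < c - x) (hp : c + x < 1) :
    isoProfile (c + x) ^ 2 - isoProfile (c - x) ^ 2 ≤ -4 * isoProfile c * quantile c * x := by
  have hd : ∀ t ∈ Set.Icc 0 x, 0 ≤ -4 * isoProfile c * quantile c
      - (-2 * isoProfile (c + t) * quantile (c + t)
        + (-2 * isoProfile (c - t) * quantile (c - t))) := by
    refine nonneg_of_deriv_nonneg (fun t ht =>
      (((hasDerivAt_deriv_isoProfile_sq (add_mem_Ioo hm hp ht)).comp_const_add c t).add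
        ((hasDerivAt_deriv_isoProfile_sq (sub_mem_Ioo hm hp ht)).comp_const_sub c t)).const_sub _)
      (by simp; linarith) (fun t ht => ?_)
    have := sq_le_sq.2 ((abs_quantile_le (add_mem_Ioo hm hp ht) (sub_mem_Ioo hm hp ht)
      (by linarith [ht.1]) (by linarith)).trans (neg_le_abs _))
    linarith
  have := nonneg_of_deriv_nonneg (b := x)
    (f := fun t => -4 * isoProfile c * quantile c * t
      - (isoProfile (c + t) ^ 2 - isoProfile (c - t) ^ 2))
    (fun t ht => ((hasDerivAt_id t).const_mul (-4 * isoProfile c * quantile c)).sub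
      (((hasDerivAt_isoProfile_sq (add_mem_Ioo hm hp ht)).comp_const_add c t).sub
        ((hasDerivAt_isoProfile_sq (sub_mem_Ioo hm hp ht)).comp_const_sub c t)))
    (by simp) (fun t ht => ?_) x ⟨hx, le_rfl⟩
  · linarith
  · have := hd t ht
    linarith

/-- The hypothesis rearranges to `(4j² - (a+b)²)(4j² - (a-b)²) ≤ 0`. If `a + b < 2j`, both factors
are positive, since `|a-b| ≤ a+b`. -/
theorem two_mul_le_add_of_sq_sub_sq {a b j : ℝ} (ha : 0 ≤ a) (hb : 0 ≤ b)
    (h : (a ^ 2 - b ^ 2) ^ 2 ≤ 8 * j ^ 2 * (a ^ 2 + b ^ 2 - 2 * j ^ 2)) : 2 * j ≤ a + b := by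
  by_contra! hlt
  have h1 : 0 < 4 * j ^ 2 - (a + b) ^ 2 := by nlinarith
  have h2 : 0 < 4 * j ^ 2 - (a - b) ^ 2 := by nlinarith
  nlinarith [mul_pos h1 h2]

theorem two_point_of_le_half (hc : c ≤ 1 / 2) (hx : 0 ≤ x) (hm : 0 < c - x) (hp : c + x < 1) :
    2 * isoProfile c ≤ √(isoProfile (c + x) ^ 2 + x ^ 2) + √(isoProfile (c - x) ^ 2 + x ^ 2) := by
  refine two_mul_le_add_of_sq_sub_sq (Real.sqrt_nonneg _) (Real.sqrt_nonneg _) ?_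
  rw [Real.sq_sqrt (by positivity), Real.sq_sqrt (by positivity)]
  have h1 := isoProfile_sq_sub_le hc hx hm hp
  have h2 := isoProfile_sq_add_ge hx hm hp
  have hxx : x ∈ Set.Icc 0 x := ⟨hx, le_rfl⟩
  -- The difference of squares must be nonnegative before its upper bound can be squared.
  have h3 : isoProfile (c - x) ^ 2 ≤ isoProfile (c + x) ^ 2 :=
    pow_le_pow_left₀ (isoProfile_nonneg _) (isoProfile_le_of_add_le_one (add_mem_Ioo hm hp hxx)
      (sub_mem_Ioo hm hp hxx) (by linarith) (by linarith)) 2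
  calc _ = (isoProfile (c + x) ^ 2 - isoProfile (c - x) ^ 2) ^ 2 := by ring
    _ ≤ (-4 * isoProfile c * quantile c * x) ^ 2 := pow_le_pow_left₀ (by linarith) h1 2
    _ = 8 * isoProfile c ^ 2 * (2 * quantile c ^ 2 * x ^ 2) := by ring
    _ ≤ 8 * isoProfile c ^ 2 * (isoProfile (c + x) ^ 2 + isoProfile (c - x) ^ 2 + 2 * x ^ 2
        - 2 * isoProfile c ^ 2) := by gcongr
    _ = _ := by ring

theorem two_point_of_nonneg (hx : 0 ≤ x) (hm : 0 < c - x) (hp : c + x < 1) :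
    2 * isoProfile c ≤ √(isoProfile (c + x) ^ 2 + x ^ 2) + √(isoProfile (c - x) ^ 2 + x ^ 2) := by
  rcases le_total c (1 / 2) with hc | hc
  · exact two_point_of_le_half hc hx hm hp
  · have h := two_point_of_le_half (c := 1 - c) (x := x) (by linarith) hx (by linarith)
      (by linarith)
    rw [isoProfile_one_sub, show 1 - c + x = 1 - (c - x) by ring,
      show 1 - c - x = 1 - (c + x) by ring, isoProfile_one_sub, isoProfile_one_sub] at h
    linarith

end TwoPoint

theorem two_point_Ioo {a b : ℝ} (ha : a ∈ Set.Ioo (0 : ℝ) 1) (hb : b ∈ Set.Ioo (0 : ℝ) 1) :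
    2 * isoProfile ((a + b) / 2) ≤ √(isoProfile a ^ 2 + ((a - b) / 2) ^ 2)
      + √(isoProfile b ^ 2 + ((a - b) / 2) ^ 2) := by
  wlog h : b ≤ a generalizing a b
  · have := this hb ha (le_of_not_ge h)
    rw [add_comm b a, show (b - a) / 2 = -((a - b) / 2) by ring, neg_sq] at this
    linarith
  have h1 := two_point_of_nonneg (c := (a + b) / 2) (x := (a - b) / 2) (by linarith)
    (by linarith [hb.1]) (by linarith [ha.2])
  rwa [show (a + b) / 2 + (a - b) / 2 = a by ring, show (a + b) / 2 - (a - b) / 2 = b by ring]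
    at h1

/-- **Bobkov's two-point inequality**. -/
theorem two_point {a b : ℝ} (ha : a ∈ Set.Icc (0 : ℝ) 1) (hb : b ∈ Set.Icc (0 : ℝ) 1) :
    2 * isoProfile ((a + b) / 2) ≤ √(isoProfile a ^ 2 + ((a - b) / 2) ^ 2)
      + √(isoProfile b ^ 2 + ((a - b) / 2) ^ 2) := by
  -- Both sides are continuous, so the inequality passes from the open square to its closure.
  have hI := continuous_isoProfile
  have hcl : IsClosed {q : ℝ × ℝ | 2 * isoProfile ((q.1 + q.2) / 2) ≤
      √(isoProfile q.1 ^ 2 + ((q.1 - q.2) / 2) ^ 2)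
        + √(isoProfile q.2 ^ 2 + ((q.1 - q.2) / 2) ^ 2)} :=
    isClosed_le (by fun_prop) (by fun_prop)
  have hsub : Set.Ioo (0 : ℝ) 1 ×ˢ Set.Ioo (0 : ℝ) 1 ⊆ {q : ℝ × ℝ | 2 * isoProfile ((q.1 + q.2) / 2)
      ≤ √(isoProfile q.1 ^ 2 + ((q.1 - q.2) / 2) ^ 2)
        + √(isoProfile q.2 ^ 2 + ((q.1 - q.2) / 2) ^ 2)} := fun q hq => two_point_Ioo hq.1 hq.2
  have h := closure_minimal hsub hcl
  rw [closure_prod_eq, closure_Ioo zero_ne_one] at h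
  exact h (show (a, b) ∈ _ from ⟨ha, hb⟩)

/-! ### Bobkov's inequality on the discrete cube -/

/-- This is the triangle inequality for the complex numbers `A x + i B x`. -/
theorem sqrt_sum_sq_add_sum_sq_le {α : Type*} (s : Finset α) (A B : α → ℝ) :
    √((∑ x ∈ s, A x) ^ 2 + (∑ x ∈ s, B x) ^ 2) ≤ ∑ x ∈ s, √(A x ^ 2 + B x ^ 2) := by
  have h := norm_sum_le s fun x => (A x + B x * Complex.I : ℂ)
  rw [Finset.sum_add_distrib, ← Finset.sum_mul, ← Complex.ofReal_sum, ← Complex.ofReal_sum,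
    Complex.norm_add_mul_I] at h
  simpa only [Complex.norm_add_mul_I] using h

theorem sum_cube_succ {N : ℕ} (g : (Fin (N + 1) → Bool) → ℝ) :
    ∑ x, g x =
      ∑ y : Fin N → Bool, g (Fin.cons true y) + ∑ y : Fin N → Bool, g (Fin.cons false y) := by
  rw [← Fintype.sum_equiv (Fin.consEquiv fun _ : Fin (N + 1) => Bool)
    (fun q => g (Fin.cons q.1 q.2)) g (fun q => rfl), Fintype.sum_prod_type, Fintype.sum_bool]

/-- The discrete gradient term on the cube. -/
noncomputable def cubeGradSq {ι : Type*} [Fintype ι] [DecidableEq ι] (f : (ι → Bool) → ℝ)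
    (x : ι → Bool) : ℝ :=
  ∑ i, ((f x - f (Function.update x i (!x i))) / 2) ^ 2

theorem cubeGradSq_nonneg {ι : Type*} [Fintype ι] [DecidableEq ι] (f : (ι → Bool) → ℝ)
    (x : ι → Bool) : 0 ≤ cubeGradSq f x := Finset.sum_nonneg fun _ _ => sq_nonneg _

theorem cubeGradSq_cons {N : ℕ} (f : (Fin (N + 1) → Bool) → ℝ) (b : Bool) (y : Fin N → Bool) :
    cubeGradSq f (Fin.cons b y) =
      ((f (Fin.cons true y) - f (Fin.cons false y)) / 2) ^ 2
        + cubeGradSq (fun y => f (Fin.cons b y)) y := by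
  simp only [cubeGradSq, Fin.sum_univ_succ, Fin.cons_zero, Fin.cons_succ, Fin.update_cons_zero,
    ← Fin.cons_update]
  congr 1
  cases b
  · simp only [Bool.not_false]; ring
  · simp only [Bool.not_true]

theorem bobkov_cube_fin : ∀ (N : ℕ) (f : (Fin N → Bool) → ℝ), (∀ x, f x ∈ Set.Icc (0 : ℝ) 1) →
    isoProfile ((2 ^ N)⁻¹ * ∑ x, f x) ≤
      (2 ^ N)⁻¹ * ∑ x, √(isoProfile (f x) ^ 2 + cubeGradSq f x) := by
  intro N
  induction N with
  | zero =>
    intro f _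
    simp [cubeGradSq, Real.sqrt_sq (isoProfile_nonneg _)]
  | succ N ih =>
    intro f hf
    set w : ℝ := (2 ^ N)⁻¹ with hw
    have hw0 : 0 ≤ w := by positivity
    -- The means over the two faces of the first coordinate; the two-point inequality is applied to
    -- them.
    set m : Bool → ℝ := fun b => w * ∑ y : Fin N → Bool, f (Fin.cons b y) with hm
    have hm_mem : ∀ b, m b ∈ Set.Icc (0 : ℝ) 1 := by
      intro b
      refine ⟨mul_nonneg hw0 (Finset.sum_nonneg fun y _ => (hf _).1), ?_⟩
      calc m b ≤ w * ∑ y : Fin N → Bool, (1 : ℝ) := by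
            simp only [hm]; gcongr with y; exact (hf _).2
        _ = 1 := by simp [hw]
    set B : (Fin N → Bool) → ℝ := fun y => (f (Fin.cons true y) - f (Fin.cons false y)) / 2
      with hB
    have hmB : (m true - m false) / 2 = ∑ y, w * B y := by
      simp only [hm, hB, ← Finset.mul_sum, ← Finset.sum_div, Finset.sum_sub_distrib]
      ring
    -- The induction hypothesis bounds `I(m b)` by an average of `A`, and the half-difference of the
    -- means is the average of `B`. The triangle inequality moves the average outside the square
    -- root, where `A² + B²` restores the gradient in all coordinates.
    have key : ∀ b, √(isoProfile (m b) ^ 2 + ((m true - m false) / 2) ^ 2) ≤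
        w * ∑ y : Fin N → Bool,
          √(isoProfile (f (Fin.cons b y)) ^ 2 + cubeGradSq f (Fin.cons b y)) := by
      intro b
      set A : (Fin N → Bool) → ℝ := fun y =>
        √(isoProfile (f (Fin.cons b y)) ^ 2 + cubeGradSq (fun y => f (Fin.cons b y)) y) with hA
      have h1 : isoProfile (m b) ≤ ∑ y, w * A y := by
        rw [← Finset.mul_sum]
        exact ih (fun y => f (Fin.cons b y)) fun y => hf _
      calc _ ≤ √((∑ y, w * A y) ^ 2 + (∑ y, w * B y) ^ 2) := by
            rw [hmB]
            gcongr
            exact isoProfile_nonneg _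
        _ ≤ ∑ y, √((w * A y) ^ 2 + (w * B y) ^ 2) := sqrt_sum_sq_add_sum_sq_le _ _ _
        _ = _ := by
            rw [Finset.mul_sum]
            refine Finset.sum_congr rfl fun y _ => ?_
            rw [mul_pow, mul_pow, ← mul_add, Real.sqrt_mul (sq_nonneg w), Real.sqrt_sq hw0, hA,
              Real.sq_sqrt (add_nonneg (sq_nonneg _) (cubeGradSq_nonneg _ _)), cubeGradSq_cons]
            congr 2
            ring
    have hw2 : (2 ^ (N + 1) : ℝ)⁻¹ = w / 2 := by rw [hw, pow_succ, mul_inv]; ring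
    have htp := two_point (hm_mem true) (hm_mem false)
    rw [hw2, sum_cube_succ, sum_cube_succ]
    have hmean : w / 2 * (∑ y : Fin N → Bool, f (Fin.cons true y)
        + ∑ y : Fin N → Bool, f (Fin.cons false y)) = (m true + m false) / 2 := by
      simp only [hm]; ring
    rw [hmean]
    linarith [key true, key false]

/-- **Bobkov's inequality** on the discrete cube. -/
theorem bobkov_cube {ι : Type*} [Fintype ι] [DecidableEq ι] (f : (ι → Bool) → ℝ)
    (hf : ∀ x, f x ∈ Set.Icc (0 : ℝ) 1) :
    isoProfile ((2 ^ Fintype.card ι)⁻¹ * ∑ x, f x) ≤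
      (2 ^ Fintype.card ι)⁻¹ * ∑ x, √(isoProfile (f x) ^ 2 + cubeGradSq f x) := by
  set e := Fintype.equivFin ι
  set E : (Fin (Fintype.card ι) → Bool) ≃ (ι → Bool) := e.symm.arrowCongr (Equiv.refl Bool) with hE
  have hEa : ∀ x i, E x i = x (e i) := fun x i => rfl
  have h := bobkov_cube_fin _ (fun x => f (E x)) fun x => hf _
  rw [Fintype.sum_equiv E (fun x => f (E x)) f fun _ => rfl,
    Fintype.sum_equiv E _ (fun x => √(isoProfile (f x) ^ 2 + cubeGradSq f x)) fun x => ?_] at h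
  · exact h
  · congr 2
    unfold cubeGradSq
    refine Fintype.sum_equiv e.symm _ _ fun i => ?_
    suffices hup : E (Function.update x i (!x i)) =
        Function.update (E x) (e.symm i) (!E x (e.symm i)) by simp only [hup]
    ext j
    rw [hEa]
    by_cases hij : j = e.symm i
    · subst hij; simp [hEa]
    · have : e j ≠ i := fun h => hij (by rw [← h, Equiv.symm_apply_apply])
      simp [hij, this, hEa]

/-! ### Weak convergence of scaled random signs to the standard Gaussian -/

/-- The sign of a bit. -/
def bitSign (b : Bool) : ℝ := if b then 1 else -1

theorem bitSign_not (b : Bool) : bitSign (!b) = -bitSign b := by cases b <;> simp [bitSign]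

theorem abs_bitSign (b : Bool) : |bitSign b| = 1 := by cases b <;> simp [bitSign]

/-- The law of a random sign. -/
noncomputable def signMeasure : Measure ℝ :=
  ∑ b : Bool, ENNReal.ofReal 2⁻¹ • Measure.dirac (bitSign b)

instance : IsProbabilityMeasure signMeasure := by
  constructor
  simp only [signMeasure, Fintype.sum_bool, Measure.coe_add, Pi.add_apply, Measure.coe_smul,
    Pi.smul_apply, measure_univ, smul_eq_mul, mul_one]
  rw [← ENNReal.ofReal_add (by norm_num) (by norm_num)]
  norm_num

theorem integral_signMeasure {F : Type*} [NormedAddCommGroup F] [NormedSpace ℝ F] [CompleteSpace F]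
    (g : ℝ → F) : ∫ y, g y ∂signMeasure = ∑ b : Bool, (2⁻¹ : ℝ) • g (bitSign b) := by
  rw [signMeasure, integral_finsetSum_measure]
  · refine Finset.sum_congr rfl fun b _ => ?_
    rw [integral_smul_measure, integral_dirac, ENNReal.toReal_ofReal (by norm_num)]
  · exact fun b _ => (integrable_dirac enorm_lt_top).smul_measure ENNReal.ofReal_ne_top

/-- Central limit theorem for a random sign, which has mean `0` and second moment `1`. -/
theorem tendsto_charFun_signMeasure_pow (t : ℝ) :
    Tendsto (fun n : ℕ => charFun signMeasure ((√n)⁻¹ * t) ^ n) atTop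
      (𝓝 (Complex.exp (-t ^ 2 / 2))) := by
  have h := tendsto_charFun_inv_sqrt_mul_pow (P := signMeasure) (X := id) aemeasurable_id
    (by rw [integral_signMeasure]; simp [bitSign]) (by rw [integral_signMeasure]; simp [bitSign]) t
  simpa only [Measure.map_id] using h

section

variable {E κ : Type*} [NormedAddCommGroup E] [InnerProductSpace ℝ E] [Fintype κ] [DecidableEq κ]

/-- The scaled sum of signs along an orthonormal basis. -/
noncomputable def signSum (b : OrthonormalBasis κ ℝ E) (n : ℕ) (x : κ × Fin n → Bool) : E :=
  ∑ p, ((√n)⁻¹ * bitSign (x p)) • b p.1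

variable [MeasurableSpace E] [BorelSpace E]

/-- The law of the scaled sum of independent signs along an orthonormal basis. -/
noncomputable def signSumMeasure (b : OrthonormalBasis κ ℝ E) (n : ℕ) : Measure E :=
  ∑ x : κ × Fin n → Bool,
    ENNReal.ofReal (2 ^ Fintype.card (κ × Fin n))⁻¹ • Measure.dirac (signSum b n x)

instance (b : OrthonormalBasis κ ℝ E) (n : ℕ) : IsProbabilityMeasure (signSumMeasure b n) := by
  constructor
  simp only [signSumMeasure, Measure.coe_finsetSum, Finset.sum_apply, Measure.coe_smul,
    Pi.smul_apply, measure_univ, smul_eq_mul, mul_one, Finset.sum_const, nsmul_eq_mul,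
    Finset.card_univ, Fintype.card_fun, Fintype.card_bool]
  rw [← ENNReal.ofReal_natCast, ← ENNReal.ofReal_mul (by positivity)]
  push_cast
  rw [mul_inv_cancel₀ (by positivity), ENNReal.ofReal_one]

theorem integral_signSumMeasure {F : Type*} [NormedAddCommGroup F] [NormedSpace ℝ F]
    [CompleteSpace F] (b : OrthonormalBasis κ ℝ E) (n : ℕ) (g : E → F) :
    ∫ y, g y ∂(signSumMeasure b n) =
      (2 ^ Fintype.card (κ × Fin n) : ℝ)⁻¹ • ∑ x : κ × Fin n → Bool, g (signSum b n x) := by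
  rw [signSumMeasure, integral_finsetSum_measure, Finset.smul_sum]
  · refine Finset.sum_congr rfl fun x _ => ?_
    rw [integral_smul_measure, integral_dirac, ENNReal.toReal_ofReal (by positivity)]
  · exact fun x _ => (integrable_dirac enorm_lt_top).smul_measure ENNReal.ofReal_ne_top

/-- The signs are independent: expanding the product of two-term averages gives the average over all
sign patterns. -/
theorem charFun_signSumMeasure (b : OrthonormalBasis κ ℝ E) (n : ℕ) (t : E) :
    charFun (signSumMeasure b n) t =
      ∏ j, charFun signMeasure ((√n)⁻¹ * inner ℝ (b j) t) ^ n := by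
  have h1 : ∏ j, charFun signMeasure ((√n)⁻¹ * inner ℝ (b j) t) ^ n =
      ∏ p : κ × Fin n, ∑ v : Bool, (2⁻¹ : ℝ) •
        Complex.exp ((((√n)⁻¹ * bitSign v) * inner ℝ (b p.1) t : ℝ) * Complex.I) := by
    rw [Fintype.prod_prod_type]
    refine Finset.prod_congr rfl fun j _ => ?_
    simp only [Finset.prod_const, Finset.card_univ, Fintype.card_fin]
    rw [charFun_apply_real,
      integral_signMeasure]
    congr 1
    refine Finset.sum_congr rfl fun v _ => ?_
    congr 2
    push_cast
    ring
  rw [h1, Fintype.prod_sum, charFun_apply, integral_signSumMeasure, Finset.smul_sum]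
  refine Finset.sum_congr rfl fun x _ => ?_
  rw [signSum, sum_inner]
  simp only [inner_smul_left, Complex.real_smul]
  rw [Finset.prod_mul_distrib, Finset.prod_const, ← Complex.exp_sum]
  simp only [Complex.ofReal_sum, Finset.sum_mul]
  simp [Finset.card_univ]

variable [FiniteDimensional ℝ E]

/-- Pointwise convergence of characteristic functions gives weak convergence by Lévy's continuity
theorem. -/
theorem tendsto_integral_signSumMeasure (b : OrthonormalBasis κ ℝ E) {g : E → ℝ}
    (hg : Continuous g) {C : ℝ} (hC : ∀ x, ‖g x‖ ≤ C) :
    Tendsto (fun n => ∫ y, g y ∂(signSumMeasure b n)) atTop (𝓝 (∫ y, g y ∂(stdGaussian E))) := by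
  set P : ℕ → ProbabilityMeasure E := fun n => ⟨signSumMeasure b n, inferInstance⟩
  set Q : ProbabilityMeasure E := ⟨stdGaussian E, inferInstance⟩
  have h : Tendsto P atTop (𝓝 Q) := by
    refine ProbabilityMeasure.tendsto_iff_tendsto_charFun.2 fun t => ?_
    have h2 := tendsto_finsetProd Finset.univ
      fun j (_ : j ∈ Finset.univ) => tendsto_charFun_signMeasure_pow (inner ℝ (b j) t)
    simp only [P, Q, ProbabilityMeasure.coe_mk, charFun_signSumMeasure, charFun_stdGaussian]
    convert h2 using 2
    rw [← Complex.exp_sum, ← Finset.sum_div, Finset.sum_neg_distrib]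
    congr 3
    rw [← Complex.ofReal_pow, ← b.sum_sq_inner_right]
    push_cast
    rfl
  exact ProbabilityMeasure.tendsto_iff_forall_integral_tendsto.1 h
    (BoundedContinuousFunction.ofNormedAddCommGroup g hg C hC)

end

/-! ### Bobkov's functional inequality for the standard Gaussian measure -/

theorem sum_sq_apply_orthonormalBasis {E κ : Type*} [NormedAddCommGroup E] [InnerProductSpace ℝ E]
    [Fintype κ] [CompleteSpace E] (b : OrthonormalBasis κ ℝ E) (l : E →L[ℝ] ℝ) :
    ∑ j, l (b j) ^ 2 = ‖l‖ ^ 2 := by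
  obtain ⟨v, rfl⟩ := (InnerProductSpace.toDual ℝ E).surjective l
  rw [LinearIsometryEquiv.norm_map, ← b.sum_sq_inner_left]
  rfl

section

variable {E κ : Type*} [NormedAddCommGroup E] [InnerProductSpace ℝ E] [Fintype κ] [DecidableEq κ]

theorem signSum_update (b : OrthonormalBasis κ ℝ E) (n : ℕ) (x : κ × Fin n → Bool)
    (p : κ × Fin n) :
    signSum b n (Function.update x p (!x p)) - signSum b n x =
      (-2 * (√n)⁻¹ * bitSign (x p)) • b p.1 := by
  rw [signSum, signSum, ← Finset.sum_sub_distrib, Finset.sum_eq_single p]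
  · rw [← sub_smul, Function.update_self, bitSign_not]
    congr 1
    ring
  · intro q _ hq
    rw [Function.update_of_ne hq, sub_self]
  · simp

/-- Flipping a sign moves the point by `2/√n` along a basis vector `b j`, so the halved difference
is `∂_j f / √n` up to an error `ω/√n`. The `n` signs attached to `b j` together contribute `(∂_j
f)²` up to `2ωC + ω²`. -/
theorem cubeGradSq_signSum_le [CompleteSpace E] (b : OrthonormalBasis κ ℝ E) {f : E → ℝ}
    (hf : Differentiable ℝ f) {C ω η : ℝ} (hC : ∀ y, ‖fderiv ℝ f y‖ ≤ C) (hω : 0 ≤ ω)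
    (hη : ∀ y z, dist y z < η → dist (fderiv ℝ f y) (fderiv ℝ f z) ≤ ω)
    {n : ℕ} (hn : 0 < n) (hnη : 2 * (√n)⁻¹ < η) (x : κ × Fin n → Bool) :
    cubeGradSq (fun x => f (signSum b n x)) x ≤
      ‖fderiv ℝ f (signSum b n x)‖ ^ 2 + Fintype.card κ * (2 * ω * C + ω ^ 2) := by
  set y := signSum b n x with hy
  set l := fderiv ℝ f y with hl
  have hn0 : (0 : ℝ) < n := by exact_mod_cast hn
  have hs : 0 < (√n)⁻¹ := inv_pos.2 (Real.sqrt_pos.2 hn0)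
  have hs2 : (√n)⁻¹ ^ 2 = (n : ℝ)⁻¹ := by rw [inv_pow, Real.sq_sqrt hn0.le]
  have hη0 : 0 < η := by linarith
  have hlb : ∀ j, |l (b j)| ≤ C := fun j => by
    have := (l.le_opNorm (b j)).trans_eq (by rw [b.norm_eq_one, mul_one])
    exact this.trans (hC y)
  have hterm : ∀ p : κ × Fin n,
      ((f y - f (signSum b n (Function.update x p (!x p)))) / 2) ^ 2 ≤
        (n : ℝ)⁻¹ * (l (b p.1) ^ 2 + (2 * ω * C + ω ^ 2)) := by
    intro p
    set z := signSum b n (Function.update x p (!x p)) with hz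
    have hzy : z - y = (-2 * (√n)⁻¹ * bitSign (x p)) • b p.1 := signSum_update b n x p
    have hnorm : ‖z - y‖ = 2 * (√n)⁻¹ := by
      rw [hzy, norm_smul, b.norm_eq_one, mul_one, Real.norm_eq_abs, abs_mul, abs_bitSign, mul_one,
        abs_mul, abs_of_pos hs]
      norm_num
    have hmv : ‖f z - f y - l (z - y)‖ ≤ ω * ‖z - y‖ := by
      refine Convex.norm_image_sub_le_of_norm_fderiv_le' (s := Metric.ball y η)
        (fun u _ => hf u) (fun u hu => ?_) (convex_ball y η) (Metric.mem_ball_self hη0) ?_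
      · rw [← dist_eq_norm]; exact hη u y hu
      · rw [Metric.mem_ball, dist_eq_norm, hnorm]; exact hnη
    have hlz : |l (z - y)| = 2 * (√n)⁻¹ * |l (b p.1)| := by
      rw [hzy, map_smul, smul_eq_mul, abs_mul, abs_mul, abs_bitSign, mul_one, abs_mul,
        abs_of_pos hs]
      norm_num
    have habs : |(f y - f z) / 2| ≤ (√n)⁻¹ * (|l (b p.1)| + ω) := by
      have h1 : |f y - f z| ≤ |l (z - y)| + ω * ‖z - y‖ := by
        rw [abs_sub_comm]
        have := abs_add_le (f z - f y - l (z - y)) (l (z - y))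
        rw [sub_add_cancel] at this
        rw [Real.norm_eq_abs] at hmv
        linarith
      rw [hlz, hnorm] at h1
      rw [abs_div, abs_two]
      linarith
    calc ((f y - f z) / 2) ^ 2 = |(f y - f z) / 2| ^ 2 := (sq_abs _).symm
      _ ≤ ((√n)⁻¹ * (|l (b p.1)| + ω)) ^ 2 := pow_le_pow_left₀ (abs_nonneg _) habs 2
      _ = (n : ℝ)⁻¹ * (l (b p.1) ^ 2 + (2 * ω * |l (b p.1)| + ω ^ 2)) := by
          rw [mul_pow, hs2, add_sq, sq_abs]; ring
      _ ≤ _ := by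
          have := hlb p.1
          gcongr
  calc _ ≤ ∑ p : κ × Fin n, (n : ℝ)⁻¹ * (l (b p.1) ^ 2 + (2 * ω * C + ω ^ 2)) :=
        Finset.sum_le_sum fun p _ => hterm p
    _ = ∑ j, (l (b j) ^ 2 + (2 * ω * C + ω ^ 2)) := by
        rw [Fintype.sum_prod_type]
        refine Finset.sum_congr rfl fun j _ => ?_
        simp only [Finset.sum_const, Finset.card_univ, Fintype.card_fin, nsmul_eq_mul]
        rw [← mul_assoc, mul_inv_cancel₀ hn0.ne', one_mul]
    _ = _ := by
        rw [Finset.sum_add_distrib, sum_sq_apply_orthonormalBasis]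
        simp only [Finset.sum_const, Finset.card_univ, nsmul_eq_mul]

variable [FiniteDimensional ℝ E] [MeasurableSpace E] [BorelSpace E]

/-- The constant `θ` absorbs the discretization error for all large `n`, so the integrand does not
depend on `n` and weak convergence applies to it. -/
theorem bobkov_stdGaussian_add (b : OrthonormalBasis κ ℝ E) {f : E → ℝ} (hf : ContDiff ℝ 1 f)
    (hfc : HasCompactSupport f) (hf01 : ∀ x, f x ∈ Set.Icc (0 : ℝ) 1) {θ : ℝ} (hθ : 0 < θ) :
    isoProfile (∫ x, f x ∂(stdGaussian E)) ≤
      ∫ x, √(isoProfile (f x) ^ 2 + ‖fderiv ℝ f x‖ ^ 2 + θ) ∂(stdGaussian E) := by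
  have hdf : Continuous (fderiv ℝ f) := hf.continuous_fderiv one_ne_zero
  have hcs : HasCompactSupport (fderiv ℝ f) := hfc.fderiv ℝ
  obtain ⟨C, hC⟩ := hcs.exists_bound_of_continuous hdf
  have hC0 : 0 ≤ C := (norm_nonneg _).trans (hC 0)
  have huc := hcs.uniformContinuous_of_continuous hdf
  obtain ⟨ω, hω0, hω⟩ : ∃ ω : ℝ, 0 < ω ∧ Fintype.card κ * (2 * ω * C + ω ^ 2) ≤ θ := by
    have ht : Tendsto (fun ω : ℝ => Fintype.card κ * (2 * ω * C + ω ^ 2)) (𝓝[>] 0) (𝓝 0) := by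
      refine (Continuous.tendsto' (by fun_prop) 0 0 (by simp)).mono_left nhdsWithin_le_nhds
    exact (eventually_mem_nhdsWithin.and
      ((ht.eventually (gt_mem_nhds hθ)).mono fun _ h => h.le)).exists
  obtain ⟨η, hη0, hη⟩ := Metric.uniformContinuous_iff.1 huc ω hω0
  have hI := continuous_isoProfile
  have hfcont := hf.continuous
  have hg : Continuous fun x => √(isoProfile (f x) ^ 2 + ‖fderiv ℝ f x‖ ^ 2 + θ) := by fun_prop
  have hleft := (hI.tendsto _).comp (tendsto_integral_signSumMeasure b hfcont (C := 1) fun x => by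
    rw [Real.norm_eq_abs, abs_le]; exact ⟨by linarith [(hf01 x).1], (hf01 x).2⟩)
  have hright := tendsto_integral_signSumMeasure b hg (C := √(1 ^ 2 + C ^ 2 + θ)) fun x => by
    rw [Real.norm_eq_abs, abs_of_nonneg (Real.sqrt_nonneg _)]
    have h1 := isoProfile_nonneg (f x)
    have h2 := isoProfile_le_one (f x)
    have h3 := hC x
    gcongr
  refine le_of_tendsto_of_tendsto hleft hright ?_
  have hlim : Tendsto (fun n : ℕ => 2 * (√n)⁻¹) atTop (𝓝 0) := by
    have := (tendsto_inv_atTop_zero.comp (Real.tendsto_sqrt_atTop.comp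
      tendsto_natCast_atTop_atTop)).const_mul (2 : ℝ)
    simpa using this
  filter_upwards [hlim.eventually (gt_mem_nhds hη0), eventually_gt_atTop 0] with n hn hn0
  simp only [Function.comp_apply, integral_signSumMeasure, smul_eq_mul]
  refine (bobkov_cube (fun x => f (signSum b n x)) fun x => hf01 _).trans ?_
  simp only [add_assoc]
  gcongr with x _
  have := cubeGradSq_signSum_le b (hf.differentiable one_ne_zero) hC hω0.le
    (fun y z h => (hη h).le) hn0 hn x
  linarith

/-- **Bobkov's inequality** for the standard Gaussian measure. -/
theorem bobkov_stdGaussian {f : E → ℝ} (hf : ContDiff ℝ 1 f)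
    (hfc : HasCompactSupport f) (hf01 : ∀ x, f x ∈ Set.Icc (0 : ℝ) 1) :
    isoProfile (∫ x, f x ∂(stdGaussian E)) ≤
      ∫ x, (isoProfile (f x) + ‖fderiv ℝ f x‖) ∂(stdGaussian E) := by
  have hdf : Continuous (fderiv ℝ f) := hf.continuous_fderiv one_ne_zero
  have hcs : HasCompactSupport (fderiv ℝ f) := hfc.fderiv ℝ
  obtain ⟨C, hC⟩ := hcs.exists_bound_of_continuous hdf
  have hI := continuous_isoProfile
  have hfcont := hf.continuous
  have hint : Integrable (fun x => isoProfile (f x) + ‖fderiv ℝ f x‖) (stdGaussian E) := by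
    refine Integrable.of_bound (C := 1 + C) (Continuous.aestronglyMeasurable (by fun_prop))
      (Eventually.of_forall fun x => ?_)
    rw [Real.norm_eq_abs, abs_of_nonneg (add_nonneg (isoProfile_nonneg _) (norm_nonneg _))]
    exact add_le_add (isoProfile_le_one _) (hC x)
  refine le_of_forall_pos_le_add fun ε hε => ?_
  refine (bobkov_stdGaussian_add (stdOrthonormalBasis ℝ E) hf hfc hf01 (pow_pos hε 2)).trans ?_
  calc _ ≤ ∫ x, (isoProfile (f x) + ‖fderiv ℝ f x‖ + ε) ∂(stdGaussian E) := by
        refine integral_mono_of_nonneg (Eventually.of_forall fun x => Real.sqrt_nonneg _)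
          (hint.add (integrable_const ε)) (Eventually.of_forall fun x => ?_)
        have h1 := isoProfile_nonneg (f x)
        have h2 := norm_nonneg (fderiv ℝ f x)
        -- For nonnegative numbers, `√(a² + b² + ε²) ≤ a + b + ε`.
        refine Real.sqrt_le_iff.2 ⟨by positivity, ?_⟩
        nlinarith [mul_nonneg h1 h2, mul_nonneg h1 hε.le, mul_nonneg h2 hε.le]
    _ = _ := by
        rw [integral_add hint (integrable_const ε)]
        simp

end

/-! ### Gaussian isoperimetry for compact sets -/

section

variable {E : Type*} [NormedAddCommGroup E] [InnerProductSpace ℝ E] [FiniteDimensional ℝ E]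
  [MeasurableSpace E] [BorelSpace E]

/-- Mollification of a bounded Lipschitz function. -/
theorem exists_contDiff_mollification {g : E → ℝ} {C : NNReal} (hg : LipschitzWith C g)
    (hg01 : ∀ x, g x ∈ Set.Icc (0 : ℝ) 1) {κ : ℝ} (hκ : 0 < κ) :
    ∃ f : E → ℝ, ContDiff ℝ 1 f ∧ LipschitzWith C f ∧ (∀ x, f x ∈ Set.Icc (0 : ℝ) 1) ∧
      ∀ x, (∀ y ∈ Metric.ball x κ, g y = g x) → f x = g x := by
  let φ : ContDiffBump (0 : E) := ⟨κ / 2, κ, by positivity, by linarith⟩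
  set w : E → ℝ := φ.normed volume with hw
  have hw0 : ∀ t, 0 ≤ w t := fun t => φ.nonneg_normed t
  have hwint : Integrable w := φ.integrable_normed
  have hw1 : ∫ t, w t = 1 := φ.integral_normed
  set f := convolution w g (ContinuousLinearMap.lsmul ℝ ℝ) volume with hf
  have hfx : ∀ x, f x = ∫ t, w t * g (x - t) := fun x => rfl
  have hint : ∀ x, Integrable fun t => w t * g (x - t) := by
    intro x
    refine hwint.mul_bdd (c := 1) ?_ (Eventually.of_forall fun t => ?_)
    · have := hg.continuous
      exact Continuous.aestronglyMeasurable (by fun_prop)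
    · rw [Real.norm_eq_abs, abs_of_nonneg (hg01 _).1]
      exact (hg01 _).2
  refine ⟨f, ?_, ?_, fun x => ⟨?_, ?_⟩, fun x hx => ?_⟩
  · have hwc : ContDiff ℝ ((1 : ℕ∞) : WithTop ℕ∞) w := φ.contDiff_normed
    have hws : HasCompactSupport w := φ.hasCompactSupport_normed
    have hgi : LocallyIntegrable g := hg.continuous.locallyIntegrable
    exact hws.contDiff_convolution_left (ContinuousLinearMap.lsmul ℝ ℝ) hwc hgi
  · refine LipschitzWith.of_dist_le_mul fun x y => ?_
    rw [hfx, hfx, Real.dist_eq, ← integral_sub (hint x) (hint y)]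
    calc |∫ t, (w t * g (x - t) - w t * g (y - t))|
        ≤ ∫ t, w t * (C * dist x y) := by
          rw [← Real.norm_eq_abs]
          refine norm_integral_le_of_norm_le (hwint.mul_const _) (Eventually.of_forall fun t => ?_)
          rw [← mul_sub, norm_mul, Real.norm_of_nonneg (hw0 t)]
          refine mul_le_mul_of_nonneg_left ?_ (hw0 t)
          have := hg.dist_le_mul (x - t) (y - t)
          rwa [dist_sub_right, dist_eq_norm] at this
      _ = C * dist x y := by rw [integral_mul_const, hw1, one_mul]
  · rw [hfx]
    exact integral_nonneg fun t => mul_nonneg (hw0 t) (hg01 _).1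
  · rw [hfx, ← hw1]
    exact integral_mono (hint x) hwint fun t => mul_le_of_le_one_right (hw0 t) (hg01 _).2
  · exact ContDiffBump.normed_convolution_eq_right (φ := φ) hx

/-- A smooth cutoff function with nearly optimal Lipschitz constant. -/
theorem exists_contDiff_cutoff {A : Set E} (hA : IsCompact A) (hne : A.Nonempty) {τ θ : ℝ}
    (hτ : 0 < τ) (hθ : 1 < θ) :
    ∃ f : E → ℝ, ContDiff ℝ 1 f ∧ HasCompactSupport f ∧ (∀ x, f x ∈ Set.Icc (0 : ℝ) 1) ∧
      (∀ x ∈ A, f x = 1) ∧ (∀ x ∉ Metric.cthickening τ A, f x = 0) ∧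
      ∀ x, ‖fderiv ℝ f x‖ ≤ θ / τ := by
  have hθ0 : 0 < θ := by linarith
  -- With slope `θ/τ` the descent from `1` to `0` takes width `τ/θ = τ - 2κ`. This leaves a flat
  -- margin `κ` at each end, so mollifying at radius `κ` keeps the values on `A` and outside the
  -- thickening.
  set κ := τ * (1 - θ⁻¹) / 2 with hκ
  have hθi : θ⁻¹ < 1 := inv_lt_one_of_one_lt₀ hθ
  have hκ0 : 0 < κ := by have := sub_pos.2 hθi; positivity
  have hsum : θ / τ * (τ - 2 * κ) = 1 := by rw [hκ]; field_simp; ring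
  set C : NNReal := ⟨θ / τ, by positivity⟩ with hC
  have hCpos : 0 < θ / τ := by positivity
  have hL : LipschitzWith C fun x => 1 + θ / τ * κ - θ / τ * Metric.infDist x A := by
    refine LipschitzWith.of_dist_le_mul fun x y => ?_
    have h := (Metric.lipschitz_infDist_pt A).dist_le_mul x y
    rw [Real.dist_eq] at h ⊢
    rw [show 1 + θ / τ * κ - θ / τ * Metric.infDist x A
        - (1 + θ / τ * κ - θ / τ * Metric.infDist y A)
        = -(θ / τ * (Metric.infDist x A - Metric.infDist y A)) by ring, abs_neg, abs_mul,
      abs_of_pos hCpos]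
    simp only [NNReal.coe_one, one_mul] at h
    exact mul_le_mul_of_nonneg_left h hCpos.le
  set g : E → ℝ := fun x => max 0 (min 1 (1 + θ / τ * κ - θ / τ * Metric.infDist x A)) with hg
  have hgL : LipschitzWith C g := (hL.const_min 1).const_max 0
  have hg01 : ∀ x, g x ∈ Set.Icc (0 : ℝ) 1 := fun x =>
    ⟨le_max_left _ _, max_le zero_le_one (min_le_left _ _)⟩
  obtain ⟨f, hf, hfL, hf01, hfg⟩ := exists_contDiff_mollification hgL hg01 hκ0
  have hg1 : ∀ x, Metric.infDist x A ≤ κ → g x = 1 := by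
    intro x hx
    have : θ / τ * Metric.infDist x A ≤ θ / τ * κ := by gcongr
    simp only [hg]
    rw [min_eq_left (by linarith), max_eq_right zero_le_one]
  have hg0 : ∀ x, τ - κ ≤ Metric.infDist x A → g x = 0 := by
    intro x hx
    have : θ / τ * (τ - κ) ≤ θ / τ * Metric.infDist x A := by gcongr
    simp only [hg]
    exact max_eq_left ((min_le_right _ _).trans (by linarith))
  have hf0 : ∀ x ∉ Metric.cthickening τ A, f x = 0 := by
    intro x hx
    have hxd : τ < Metric.infDist x A := by
      rw [Metric.mem_cthickening_iff, not_le] at hx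
      rw [Metric.infDist]
      exact (ENNReal.ofReal_lt_iff_lt_toReal hτ.le (Metric.infEDist_ne_top hne)).1 hx
    rw [hfg x fun y hy => ?_, hg0 x (by linarith)]
    rw [hg0 x (by linarith), hg0 y]
    have := Metric.infDist_le_infDist_add_dist (s := A) (x := x) (y := y)
    rw [dist_comm] at this
    linarith [Metric.mem_ball.1 hy]
  refine ⟨f, hf, HasCompactSupport.intro hA.cthickening hf0, hf01, fun x hx => ?_, hf0,
    fun x => norm_fderiv_le_of_lipschitz ℝ hfL⟩
  have hxd : Metric.infDist x A = 0 := Metric.infDist_zero_of_mem hx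
  rw [hfg x fun y hy => ?_, hg1 x (by linarith)]
  rw [hg1 x (by linarith), hg1 y]
  have := Metric.infDist_le_infDist_add_dist (s := A) (x := y) (y := x)
  linarith [Metric.mem_ball.1 hy]

/-- For a cutoff `f`, the terms `I(f)` and `∇f` vanish where `f` is `0` or `1` (an extremum), and
elsewhere their sum is at most `1 + θ/τ`; then `θ → 1`. Since `∫ f` lies between the two measures,
quasi-concavity bounds `I(∫ f)` below by the minimum. -/
theorem min_isoProfile_le_measure_cthickening {A : Set E} (hA : IsCompact A) (hne : A.Nonempty)
    {τ : ℝ} (hτ : 0 < τ) :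
    min (isoProfile ((stdGaussian E).real A))
        (isoProfile ((stdGaussian E).real (Metric.cthickening τ A))) ≤
      (1 + 1 / τ) * ((stdGaussian E).real (Metric.cthickening τ A) - (stdGaussian E).real A) := by
  set ν := stdGaussian E
  set B := Metric.cthickening τ A
  have hAB : A ⊆ B := Metric.self_subset_cthickening A
  have hAm : MeasurableSet A := hA.measurableSet
  have hBm : MeasurableSet B := Metric.isClosed_cthickening.measurableSet
  have key : ∀ θ : ℝ, 1 < θ → min (isoProfile (ν.real A)) (isoProfile (ν.real B)) ≤
      (1 + θ / τ) * (ν.real B - ν.real A) := by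
    intro θ hθ
    obtain ⟨f, hf, hfc, hf01, hf1, hf0, hfd⟩ := exists_contDiff_cutoff hA hne hτ hθ
    have hint : Integrable f ν := hf.continuous.integrable_of_hasCompactSupport hfc
    have ha : ν.real A ≤ ∫ x, f x ∂ν := by
      rw [← integral_indicator_one hAm]
      refine integral_mono ((integrable_const 1).indicator hAm) hint fun x => ?_
      by_cases hx : x ∈ A
      · simp [hx, hf1 x hx]
      · simpa [hx] using (hf01 x).1
    have hb : ∫ x, f x ∂ν ≤ ν.real B := by
      rw [← integral_indicator_one hBm]
      refine integral_mono hint ((integrable_const 1).indicator hBm) fun x => ?_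
      by_cases hx : x ∈ B
      · simpa [hx] using (hf01 x).2
      · simp [hx, hf0 x hx]
    have hD : ∫ x, (B \ A).indicator (fun _ => 1 + θ / τ) x ∂ν =
        (1 + θ / τ) * (ν.real B - ν.real A) := by
      rw [integral_indicator_const _ (hBm.diff hAm), measureReal_sdiff hAB hAm, smul_eq_mul,
        mul_comm]
    rw [← hD]
    refine ((min_isoProfile_le measureReal_nonneg measureReal_le_one ha hb).trans
      (bobkov_stdGaussian hf hfc hf01)).trans ?_
    refine integral_mono_of_nonneg (Eventually.of_forall fun x =>
      add_nonneg (isoProfile_nonneg _) (norm_nonneg _))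
      ((integrable_const _).indicator (hBm.diff hAm)) (Eventually.of_forall fun x => ?_)
    by_cases hx : x ∈ A
    · have hmax : fderiv ℝ f x = 0 := IsLocalMax.fderiv_eq_zero
        (Eventually.of_forall fun y => by rw [hf1 x hx]; exact (hf01 y).2)
      simp [hx, hf1 x hx, hmax, isoProfile_one]
    by_cases hxB : x ∈ B
    · simpa [hx, hxB] using add_le_add (isoProfile_le_one (f x)) (hfd x)
    · have hmin : fderiv ℝ f x = 0 := IsLocalMin.fderiv_eq_zero
        (Eventually.of_forall fun y => by rw [hf0 x hxB]; exact (hf01 y).1)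
      simp [hxB, hf0 x hxB, hmin, isoProfile_zero]
  have hlim : Tendsto (fun θ : ℝ => (1 + θ / τ) * (ν.real B - ν.real A)) (𝓝[>] 1)
      (𝓝 ((1 + 1 / τ) * (ν.real B - ν.real A))) :=
    (Continuous.tendsto (by fun_prop) 1).mono_left nhdsWithin_le_nhds
  exact ge_of_tendsto hlim (eventually_mem_nhdsWithin.mono key)

/-- The mean value theorem writes `Φ(y') - Φ(y)` as `φ(ξ)(y' - y)`, and over distances below `τ`
inside `[-R, R]` the density varies by a factor of at least `1 - Rτ`. Cancelling `φ(ξ)` shows that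
the increment is `τ` up to second order. -/
theorem add_le_of_min_stdDensity_le {y y' R τ : ℝ} (hyy : y ≤ y') (hy : |y| ≤ R) (hy' : |y'| ≤ R)
    (hτ : 0 < τ)
    (h : min (stdDensity y) (stdDensity y') ≤ (1 + 1 / τ) * (Phi (y' : ℝ) - Phi (y : ℝ))) :
    y + τ * ((1 - R * τ) / (1 + τ)) ≤ y' := by
  have hR : 0 ≤ R := (abs_nonneg y).trans hy
  rcases le_or_gt (y + τ) y' with hle | hlt
  · refine le_trans ?_ hle
    gcongr
    refine mul_le_of_le_one_right hτ.le ((div_le_one (by linarith)).2 ?_)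
    nlinarith
  rcases hyy.eq_or_lt with rfl | hyy
  · have := lt_min (stdDensity_pos y) (stdDensity_pos y)
    rw [sub_self, mul_zero] at h
    linarith
  obtain ⟨ξ, hξ, hslope⟩ := exists_hasDerivAt_eq_slope (fun y : ℝ => Phi y) stdDensity hyy
    continuous_Phi_coe.continuousOn fun x _ => hasDerivAt_Phi x
  rw [eq_div_iff (by linarith)] at hslope
  rw [← hslope] at h
  have hbound : ∀ m, |m| ≤ R → |ξ - m| ≤ τ → stdDensity ξ * (1 - R * τ) ≤ stdDensity m := by
    intro m hm hξm
    rw [stdDensity_eq_mul_exp m ξ]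
    refine mul_le_mul_of_nonneg_left ?_ (stdDensity_pos ξ).le
    refine le_trans ?_ (Real.add_one_le_exp _)
    have hξR : |ξ| ≤ R := by
      rw [abs_le] at hy hy' ⊢
      exact ⟨by linarith [hξ.1], by linarith [hξ.2]⟩
    have h1 : |ξ ^ 2 - m ^ 2| ≤ (R + R) * τ := by
      rw [sq_sub_sq, abs_mul]
      exact mul_le_mul ((abs_add_le _ _).trans (add_le_add hξR hm)) hξm (abs_nonneg _) (by linarith)
    linarith [neg_abs_le (ξ ^ 2 - m ^ 2)]
  have h1 : stdDensity ξ * (1 - R * τ) ≤ min (stdDensity y) (stdDensity y') := by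
    refine le_min (hbound y hy ?_) (hbound y' hy' ?_)
    · rw [abs_le]; constructor <;> linarith [hξ.1, hξ.2]
    · rw [abs_le]; constructor <;> linarith [hξ.1, hξ.2]
  have h2 : stdDensity ξ * (1 - R * τ) ≤ stdDensity ξ * ((1 + 1 / τ) * (y' - y)) :=
    (h1.trans h).trans_eq (by ring)
  have h3 := le_of_mul_le_mul_left h2 (stdDensity_pos ξ)
  have h4 : τ * ((1 - R * τ) / (1 + τ)) ≤ τ * (((1 + 1 / τ) * (y' - y)) / (1 + τ)) := by gcongr
  have h5 : τ * (((1 + 1 / τ) * (y' - y)) / (1 + τ)) = y' - y := by field_simp; ring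
  linarith

/-- **Gaussian isoperimetric inequality** for compact sets, in terms of quantiles. -/
theorem quantile_add_le_cthickening {A : Set E} (hA : IsCompact A) {s : ℝ} (hs : 0 < s)
    (hpos : 0 < (stdGaussian E).real A)
    (hlt : (stdGaussian E).real (Metric.cthickening s A) < 1) :
    quantile ((stdGaussian E).real A) + s ≤
      quantile ((stdGaussian E).real (Metric.cthickening s A)) := by
  set ν := stdGaussian E
  have hne : A.Nonempty := by
    rw [Set.nonempty_iff_ne_empty]
    rintro rfl
    simp at hpos
  set G : ℝ → ℝ := fun t => ν.real (Metric.cthickening t A) with hG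
  have hG0 : G 0 = ν.real A := by
    simp only [hG, Metric.cthickening_zero, hA.isClosed.closure_eq]
  have hGmono : Monotone G := fun a b hab => measureReal_mono (Metric.cthickening_mono hab A)
  have hGmem : ∀ t ∈ Set.Icc 0 s, G t ∈ Set.Ioo (0 : ℝ) 1 := fun t ht =>
    ⟨hpos.trans_le (hG0 ▸ hGmono ht.1), (hGmono ht.2).trans_lt hlt⟩
  set Q : ℝ → ℝ := fun t => quantile (G t) with hQ
  have hQmono : ∀ t ∈ Set.Icc 0 s, ∀ t' ∈ Set.Icc 0 s, t ≤ t' → Q t ≤ Q t' :=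
    fun t ht t' ht' h => strictMonoOn_quantile.monotoneOn (hGmem t ht) (hGmem t' ht') (hGmono h)
  set R := max |Q 0| |Q s| with hR
  have hQR : ∀ t ∈ Set.Icc 0 s, |Q t| ≤ R := fun t ht =>
    abs_le_max_abs_abs (hQmono 0 ⟨le_rfl, hs.le⟩ t ht ht.1) (hQmono t ht s ⟨hs.le, le_rfl⟩ ht.2)
  have hstep : ∀ t τ : ℝ, 0 ≤ t → 0 < τ → t + τ ≤ s →
      Q t + τ * ((1 - R * τ) / (1 + τ)) ≤ Q (t + τ) := by
    intro t τ ht hτ hts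
    have h1 : t ∈ Set.Icc 0 s := ⟨ht, by linarith⟩
    have h2 : t + τ ∈ Set.Icc 0 s := ⟨by linarith, hts⟩
    refine add_le_of_min_stdDensity_le (hQmono t h1 _ h2 (by linarith)) (hQR t h1) (hQR _ h2) hτ ?_
    have h := min_isoProfile_le_measure_cthickening (hA.cthickening (r := t))
      (hne.mono (Metric.self_subset_cthickening A)) hτ
    rw [cthickening_cthickening hτ.le ht, add_comm τ t] at h
    change min (isoProfile (G t)) (isoProfile (G (t + τ))) ≤ (1 + 1 / τ) * (G (t + τ) - G t) at h
    rwa [isoProfile_of_mem (hGmem t h1), isoProfile_of_mem (hGmem _ h2),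
      ← Phi_quantile (hGmem t h1), ← Phi_quantile (hGmem _ h2), quantile_Phi, quantile_Phi] at h
  -- With `n` steps of length `s/n`, the common loss factor tends to `1` because `R` is uniform over
  -- `[0, s]`.
  have hiter : ∀ n : ℕ, 0 < n → Q 0 + s * ((1 - R * (s / n)) / (1 + s / n)) ≤ Q s := by
    intro n hn
    have hn0 : (0 : ℝ) < n := by exact_mod_cast hn
    have hτ : 0 < s / n := by positivity
    have hk : ∀ k : ℕ, k ≤ n →
        Q 0 + k * (s / n * ((1 - R * (s / n)) / (1 + s / n))) ≤ Q (k * (s / n)) := by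
      intro k
      induction k with
      | zero => intro _; simp
      | succ k ih =>
        intro hkn
        have h1 := ih (by omega)
        have h2 : ((k : ℝ) + 1) * (s / n) ≤ s := by
          have : ((k : ℝ) + 1) ≤ n := by exact_mod_cast hkn
          calc _ ≤ (n : ℝ) * (s / n) := by gcongr
            _ = s := mul_div_cancel₀ _ hn0.ne'
        have h3 := hstep (k * (s / n)) (s / n) (by positivity) hτ (by linarith)
        push_cast
        rw [show ((k : ℝ) + 1) * (s / n) = k * (s / n) + s / n by ring]
        linarith
    have h := hk n le_rfl
    rwa [mul_div_cancel₀ _ hn0.ne', ← mul_assoc, mul_div_cancel₀ _ hn0.ne'] at h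
  have hlim : Tendsto (fun n : ℕ => Q 0 + s * ((1 - R * (s / n)) / (1 + s / n))) atTop
      (𝓝 (Q 0 + s * ((1 - R * 0) / (1 + 0)))) := by
    have h := tendsto_const_div_atTop_nhds_zero_nat s
    exact (((h.const_mul R).const_sub 1).div (h.const_add 1) (by norm_num)).const_mul s
      |>.const_add (Q 0)
  have h := le_of_tendsto hlim ((eventually_gt_atTop 0).mono hiter)
  simpa [hQ, hG0] using h

end

/-! ### Gaussian isoperimetry for measurable sets -/

theorem PhiInv_mono : Monotone PhiInv := fun _ _ h => sInf_le_sInf fun _ hx => h.trans hx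

theorem PhiInv_zero : PhiInv 0 = ⊥ := by rw [← Phi_bot, PhiInv_Phi]

theorem PhiInv_one : PhiInv 1 = ⊤ := by rw [← Phi_top, PhiInv_Phi]

theorem Phi_le_one (x : EReal) : Phi x ≤ 1 := Phi_top ▸ Phi_strictMono.monotone le_top

section

variable {E : Type*} [NormedAddCommGroup E] [InnerProductSpace ℝ E] [FiniteDimensional ℝ E]
  [MeasurableSpace E] [BorelSpace E]

/-- **Gaussian isoperimetric inequality** for compact sets. -/
theorem Phi_add_le_cthickening {A : Set E} (hA : IsCompact A) {s : ℝ} (hs : 0 < s) :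
    Phi (PhiInv ((stdGaussian E).real A) + s) ≤
      (stdGaussian E).real (Metric.cthickening s A) := by
  rcases (measureReal_le_one (μ := stdGaussian E) (s := Metric.cthickening s A)).eq_or_lt
    with h1 | h1
  · rw [h1]; exact Phi_le_one _
  rcases (measureReal_nonneg (μ := stdGaussian E) (s := A)).eq_or_lt with h0 | h0
  · rw [← h0, PhiInv_zero, EReal.bot_add, Phi_bot]
    exact measureReal_nonneg
  have hle : (stdGaussian E).real A ≤ (stdGaussian E).real (Metric.cthickening s A) :=
    measureReal_mono (Metric.self_subset_cthickening A)
  have ha : (stdGaussian E).real A ∈ Set.Ioo (0 : ℝ) 1 := ⟨h0, hle.trans_lt h1⟩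
  have hb : (stdGaussian E).real (Metric.cthickening s A) ∈ Set.Ioo (0 : ℝ) 1 :=
    ⟨h0.trans_le hle, h1⟩
  rw [← coe_quantile ha, ← EReal.coe_add]
  conv_rhs => rw [← Phi_quantile hb]
  exact Phi_strictMono.monotone (EReal.coe_le_coe_iff.2 (quantile_add_le_cthickening hA hs h0 h1))

/-- Inner regularity gives compact subsets of measure above any `a < ν(S)`, and `Φ(Φ⁻¹(a) + s)` is
left-continuous in `a`. -/
theorem Phi_PhiInv_add_le_of_compact {S : Set E} (hS : MeasurableSet S) {s : ℝ} (hs : 0 < s)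
    {c : ℝ} (h : ∀ A ⊆ S, IsCompact A → Phi (PhiInv ((stdGaussian E).real A) + s) ≤ c) :
    Phi (PhiInv ((stdGaussian E).real S) + s) ≤ c := by
  have happrox : ∀ a, 0 ≤ a → a < (stdGaussian E).real S → Phi (PhiInv a + s) ≤ c := by
    intro a ha0 ha
    obtain ⟨A, hAS, hA, hlt⟩ := hS.exists_lt_isCompact
      ((ENNReal.ofReal_lt_iff_lt_toReal ha0 (measure_ne_top _ _)).2 ha)
    refine le_trans (Phi_strictMono.monotone ?_) (h A hAS hA)
    gcongr
    exact PhiInv_mono ((ENNReal.ofReal_lt_iff_lt_toReal ha0 (measure_ne_top _ _)).1 hlt).le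
  rcases (measureReal_nonneg (μ := stdGaussian E) (s := S)).eq_or_lt with h0 | h0
  · have := h ∅ (Set.empty_subset S) isCompact_empty
    rwa [measureReal_empty, h0] at this
  rcases (measureReal_le_one (μ := stdGaussian E) (s := S)).eq_or_lt with h1 | h1
  · rw [h1, PhiInv_one, EReal.top_add_coe, Phi_top]
    -- At full measure the quantile is `⊤`, so the limit is replaced by the bound `a ≤ Φ(Φ⁻¹(a) + s)
    -- ≤ c` for `0 ≤ a < 1`.
    refine le_of_forall_lt_imp_le_of_dense fun a ha => ?_
    rcases lt_or_ge a 0 with ha0 | ha0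
    · exact ha0.le.trans (le_trans measureReal_nonneg (happrox 0 le_rfl h0))
    refine le_trans ?_ (happrox a ha0 (ha.trans_eq h1.symm))
    conv_lhs => rw [← Phi_PhiInv ⟨ha0, ha.le⟩]
    refine Phi_strictMono.monotone (le_add_of_nonneg_right ?_)
    exact_mod_cast hs.le
  · have hp : (stdGaussian E).real S ∈ Set.Ioo (0 : ℝ) 1 := ⟨h0, h1⟩
    rw [← coe_quantile hp, ← EReal.coe_add]
    have hlim : Tendsto (fun y : ℝ => Phi ((y + s : ℝ) : EReal))
        (𝓝[<] (quantile ((stdGaussian E).real S)))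
        (𝓝 (Phi ((quantile ((stdGaussian E).real S) + s : ℝ) : EReal))) :=
      ((continuous_Phi_coe.comp (continuous_id.add continuous_const)).tendsto _).mono_left
        nhdsWithin_le_nhds
    refine le_of_tendsto hlim (eventually_mem_nhdsWithin.mono fun y hy => ?_)
    have := happrox (Phi y) (Phi_coe_mem_Ioo y).1.le
      (by rw [← Phi_quantile hp]; exact Phi_strictMono (EReal.coe_lt_coe_iff.2 hy))
    rwa [PhiInv_Phi, ← EReal.coe_add] at this

/-- Gaussian isoperimetry for a measurable set, intersected with an arbitrary set of large
outer measure. -/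
theorem Phi_add_sub_le_neighborhood_inter {S : Set E} (hS : MeasurableSet S) {s : ℝ} (hs : 0 < s)
    {G : Set E} {δ : ℝ} (hG : 1 - δ ≤ (stdGaussian E).real G) :
    Phi (PhiInv ((stdGaussian E).real S) + s) - δ ≤
      (stdGaussian E).real ({z | ∃ z' ∈ S, dist z' z ≤ s} ∩ G) := by
  rw [sub_le_iff_le_add]
  refine Phi_PhiInv_add_le_of_compact hS hs fun A hAS hA => (Phi_add_le_cthickening hA hs).trans ?_
  have hBm : MeasurableSet (Metric.cthickening s A) := Metric.isClosed_cthickening.measurableSet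
  -- The set `G` may be nonmeasurable; the Carathéodory split only needs the closed thickening to be
  -- measurable.
  have h1 : (stdGaussian E).real (G ∩ Metric.cthickening s A)
      + (stdGaussian E).real (G \ Metric.cthickening s A) = (stdGaussian E).real G :=
    measureReal_inter_add_sdiff hBm
  have h2 : (stdGaussian E).real (G \ Metric.cthickening s A) ≤
      1 - (stdGaussian E).real (Metric.cthickening s A) := by
    rw [← probReal_compl_eq_one_sub hBm]
    exact measureReal_mono fun x hx => hx.2
  have h3 : (stdGaussian E).real (G ∩ Metric.cthickening s A) ≤
      (stdGaussian E).real ({z | ∃ z' ∈ S, dist z' z ≤ s} ∩ G) := by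
    refine measureReal_mono fun x hx => ⟨?_, hx.1⟩
    have hx2 := hx.2
    rw [hA.cthickening_eq_biUnion_closedBall hs.le] at hx2
    obtain ⟨z, hz, hxz⟩ := Set.mem_iUnion₂.1 hx2
    exact ⟨z, hAS hz, by rw [dist_comm]; exact hxz⟩
  linarith

end

/-! ### Adversarial risk of conditional generative models -/

namespace CondGenModel

variable {d K : ℕ} {X : Type*} [MeasurableSpace X] (M : CondGenModel d K X)

theorem jointMeasure_apply (S : Set (X × Fin K)) :
    M.jointMeasure S =
      ∑ i, ENNReal.ofReal (M.p i) * (M.classMeasure i).map (fun x => (x, i)) S := by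
  simp [jointMeasure]

theorem Generates.apply {M : CondGenModel d K X} {μ : Measure X} (hM : M.Generates μ)
    (S : Set X) : μ S = ∑ i, ENNReal.ofReal (M.p i) * M.classMeasure i S := by
  have h : μ = ∑ i, ENNReal.ofReal (M.p i) • M.classMeasure i := hM
  rw [h]
  simp

theorem Generates.sum_p {M : CondGenModel d K X} {μ : Measure X} [IsProbabilityMeasure μ]
    (hM : M.Generates μ) : ∑ i, M.p i = 1 := by
  have h := hM.apply Set.univ
  have hi : ∀ i, M.classMeasure i Set.univ = 1 := fun i => by
    rw [classMeasure, Measure.map_apply (M.measurable_g i) MeasurableSet.univ, Set.preimage_univ,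
      measure_univ]
  simp only [hi, mul_one, measure_univ] at h
  rw [← ENNReal.ofReal_sum_of_nonneg fun i _ => (M.p_mem i).1] at h
  exact ENNReal.ofReal_eq_one.1 h.symm

theorem Generates.jointMeasure_le {M : CondGenModel d K X} {μ : Measure X} (hM : M.Generates μ)
    {S : Set (X × Fin K)} {A : Set X} (hSA : ∀ q ∈ S, q.1 ∈ A) : M.jointMeasure S ≤ μ A := by
  -- A measurable hull of `A` is needed because neither `S` nor `A` need be measurable.
  set T := toMeasurable μ A
  have hT : MeasurableSet T := measurableSet_toMeasurable μ A
  have hST : S ⊆ Prod.fst ⁻¹' T := fun q hq => subset_toMeasurable μ A (hSA q hq)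
  calc M.jointMeasure S ≤ M.jointMeasure (Prod.fst ⁻¹' T) := measure_mono hST
    _ = μ T := by
        rw [jointMeasure_apply, hM.apply]
        refine Finset.sum_congr rfl fun i _ => ?_
        rw [Measure.map_apply measurable_prodMk_right (measurable_fst hT)]
        rfl
    _ = μ A := measure_toMeasurable A

/-- For a nonmeasurable set, the pushforward can exceed the outer measure of the preimage but never
falls below it, which is the direction required. -/
theorem sum_le_jointMeasure_real {S : Set (X × Fin K)} (hS : M.jointMeasure S ≠ ⊤) :
    ∑ i, M.p i * (nu d).real {z | (M.g i z, i) ∈ S} ≤ M.jointMeasure.real S := by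
  have h : ∑ i, ENNReal.ofReal (M.p i) * nu d {z | (M.g i z, i) ∈ S} ≤ M.jointMeasure S := by
    rw [jointMeasure_apply]
    gcongr with i
    rw [classMeasure, Measure.map_map measurable_prodMk_right (M.measurable_g i)]
    exact Measure.le_map_apply
      (measurable_prodMk_right.comp (M.measurable_g i)).aemeasurable S
  have h2 := ENNReal.toReal_mono hS h
  rw [ENNReal.toReal_sum fun i _ => ENNReal.mul_ne_top ENNReal.ofReal_ne_top (measure_ne_top _ _)]
    at h2
  simpa only [ENNReal.toReal_mul, Measure.real, ENNReal.toReal_ofReal (M.p_mem _).1] using h2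

end CondGenModel

/-- Lower bound for the latent measure of the points having an in-distribution adversarial
example with respect to the error set `B`. -/
theorem Phi_add_sub_le_of_locLipschitz {d : ℕ} {X : Type*} [MetricSpace X] [MeasurableSpace X]
    {g : EuclideanSpace ℝ (Fin d) → X} (hg : Measurable g) {B : Set X} (hB : MeasurableSet B)
    {ε r L δ : ℝ} (hε : 0 < ε) (hr : 0 < r) (hL : LocLipschitzWithProb g r L δ)
    (hrL : ε ≤ r * L) :
    Phi (PhiInv (((nu d).map g).real B) + ((ε / L : ℝ) : EReal)) - δ ≤
      (nu d).real {z | ∃ z', g z' ∈ Metric.closedBall (g z) ε ∧ g z' ∈ B} := by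
  have hL0 : 0 < L := pos_of_mul_pos_right (hε.trans_le hrL) hr.le
  rw [map_measureReal_apply hg hB]
  refine (Phi_add_sub_le_neighborhood_inter (hg hB) (div_pos hε hL0) hL).trans
    (measureReal_mono ?_)
  rintro z ⟨⟨z', hz', hd⟩, hz⟩
  refine ⟨z', ?_, hz'⟩
  have hdr : dist z' z ≤ r := hd.trans ((div_le_iff₀ hL0).2 hrL)
  refine (hz z' hdr).trans ?_
  rw [← dist_eq_norm]
  calc L * dist z' z ≤ L * (ε / L) := by gcongr
    _ = ε := mul_div_cancel₀ _ hL0.ne'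

theorem theorem1 {d K : ℕ} {X : Type*} [MetricSpace X] [MeasurableSpace X]
    (μ : Measure X) [IsProbabilityMeasure μ]
    (fstar : X → Fin K) (hfstar : Measurable fstar)
    (M : CondGenModel d K X) (hM : M.Generates μ)
    (ε : ℝ) (hε : 0 < ε) (r : ℝ) (hr : 0 < r) (δ : ℝ) (hδ : δ ∈ Set.Ioc (0 : ℝ) 1)
    (L : Fin K → ℝ → ℝ)
    (hLip : ∀ i, LocLipschitzWithProb (M.g i) r (L i r) δ)
    (hrL : ∀ i, ε ≤ r * L i r)
    (f : X → Fin K) (hf : Measurable f) :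
    M.InAdvRisk fstar f ε ≤ AdvRisk μ fstar f ε ∧
      ∑ i, M.p i * Phi (PhiInv (Risk (M.classMeasure i) fstar f) + ((ε / L i r : ℝ) : EReal)) - δ
        ≤ M.InAdvRisk fstar f ε := by
  have hle := hM.jointMeasure_le
    (S := {q : X × Fin K | ∃ z' : EuclideanSpace ℝ (Fin d),
      M.g q.2 z' ∈ Metric.closedBall q.1 ε ∧ f (M.g q.2 z') ≠ fstar (M.g q.2 z')})
    (A := {x | ∃ x' ∈ Metric.closedBall x ε, f x' ≠ fstar x'})
    fun q ⟨z', h1, h2⟩ => ⟨M.g q.2 z', h1, h2⟩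
  refine ⟨ENNReal.toReal_mono (measure_ne_top _ _) hle, ?_⟩
  refine le_trans ?_ (M.sum_le_jointMeasure_real (ne_top_of_le_ne_top (measure_ne_top _ _) hle))
  have hB : MeasurableSet {x | f x ≠ fstar x} := (measurableSet_eq_fun hf hfstar).compl
  -- As the weights sum to `1`, the single `δ` is distributed over the classes.
  calc _ = ∑ i, M.p i * (Phi (PhiInv (Risk (M.classMeasure i) fstar f)
        + ((ε / L i r : ℝ) : EReal)) - δ) := by
        simp only [mul_sub, Finset.sum_sub_distrib]
        rw [← Finset.sum_mul, hM.sum_p, one_mul]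
    _ ≤ _ := by
        gcongr with i
        · exact (M.p_mem i).1
        · exact Phi_add_sub_le_of_locLipschitz (M.measurable_g i) hB hε hr (hLip i) (hrL i)
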